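/- Let $d\ge 1$ and work on $\mathbb R^d$ with complex-valued functions. Let $\mathcal F f(\xi)=\hat f(\xi)=\int_{\mathbb R^d} f(x)e^{-2\pi i x\cdot\xi}\,dx$ on the Schwartz class $\mathcal S$, extended to the tempered distributions $\mathcal S'$ by $\langle\hat f,g\rangle=\langle f,\hat g\rangle$, and let $\mathcal P\subset\mathcal S'$ be the space of polynomials. Let $\varphi\in\mathcal S$ be any function such that $\hat\varphi$ is radially decreasing, $\hat\varphi(\xi)=1$ for $|\xi|\le 1$ and $\hat\varphi(\xi)=0$ for $|\xi|\ge 2$. For $k\in\mathbb Z$ define $\varphi_k\in\mathcal S$ by $\hat\varphi_k(\xi)=\hat\varphi_0(2^{-k}\xi)$, where $\hat\varphi_0(\xi)=\hat\varphi(\xi/2)-\hat\varphi(\xi)$. For $1<p,q<\infty$ and $s\in\mathbb R$ let $$\|f\|_{\dot F^{p,q}_s}=\Big\|\Big(\sum_{k\in\mathbb Z}\big|2^{ks}(\varphi_k*f)\big|^q\Big)^{1/q}\Big\|_{L^p},\qquad \dot F^{p,q}_s=\{[f]\in\mathcal S'/\mathcal P:\ \|f\|_{\dot F^{p,q}_s}<\infty\},$$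 and let $\dot W^p_s=\dot F^{p,2}_s$ be the homogeneous Sobolev space. Write $r'=r/(r-1)$. We say that $\mathcal F\colon L^p\to\dot F^{r,q}_s$ is bounded if $[\hat f]\in\dot F^{r,q}_s$ for every $f\in L^p$ and there is a constant $C<\infty$ with $\|\hat f\|_{\dot F^{r,q}_s}\le C\|f\|_{L^p}$ for all $f\in L^p$. **Theorem.** Let $2<p<\infty$. 1. Let $1<r,q<\infty$ and $s\in\mathbb R$. If $\mathcal F\colon L^p\to\dot F^{r,q}_s$ is bounded, then $s=d(1/p-1/r')$ and $r\ge p$; and if $r>p$, then $\dot W^p_{d(2/p-1)}\subsetneq\dot F^{r,q}_s$. 2. In particular, let $1<r<\infty$ and $s\in\mathbb R$. If $\mathcal F\colon L^p\to\dot W^r_s$ is bounded, then $\dot W^p_{d(2/p-1)}\subseteq\dot W^r_s$, with equality if and only if $r=p$ and $s=d(2/p-1)$. -/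

import Mathlib

open MeasureTheory SchwartzMap FourierTransform
open scoped ENNReal NNReal

/-- The space `ℝ^d` with its Euclidean norm. -/
abbrev Rd (d : ℕ) : Type := EuclideanSpace ℝ (Fin d)

/-- The dilation `g ↦ g(2^{-k} ·)` on Schwartz functions. -/
noncomputable def dyadicDilation {d : ℕ} (k : ℤ) (g : 𝓢(Rd d, ℂ)) : 𝓢(Rd d, ℂ) :=
  compCLMOfContinuousLinearEquiv ℂ
    (ContinuousLinearEquiv.smulLeft (M₁ := Rd d) (R₁ := ℝ)
      (Units.mk0 ((2 : ℝ) ^ (-k)) (by positivity))) g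

theorem dyadicDilation_apply {d : ℕ} (k : ℤ) (g : 𝓢(Rd d, ℂ)) (x : Rd d) :
    dyadicDilation k g x = g ((2 : ℝ) ^ (-k) • x) := rfl

/-- An admissible averaging kernel: a Schwartz function `φ` whose Fourier transform is a
(real-valued) radially decreasing function, equal to `1` for `|ξ| ≤ 1` and to `0` for `|ξ| ≥ 2`. -/
structure AveragingKernel (d : ℕ) where
  φ : 𝓢(Rd d, ℂ)
  radially_decreasing :
    ∃ h : ℝ → ℝ, AntitoneOn h (Set.Ici 0) ∧ ∀ ξ : Rd d, 𝓕 φ ξ = (h ‖ξ‖ : ℂ)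
  eq_one : ∀ ξ : Rd d, ‖ξ‖ ≤ 1 → 𝓕 φ ξ = 1
  eq_zero : ∀ ξ : Rd d, 2 ≤ ‖ξ‖ → 𝓕 φ ξ = 0

/-- The Fourier transform of the dyadic piece `φ_k`: it is `ξ ↦ m (2^{-k} ξ)` with
`m ξ = 𝓕 φ (ξ / 2) - 𝓕 φ ξ`. -/
noncomputable def AveragingKernel.symbol {d : ℕ} (K : AveragingKernel d) (k : ℤ) : 𝓢(Rd d, ℂ) :=
  dyadicDilation k (dyadicDilation 1 (𝓕 K.φ) - 𝓕 K.φ)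

/-- The dyadic pieces `φ_k`, `k ∈ ℤ`. -/
noncomputable def AveragingKernel.piece {d : ℕ} (K : AveragingKernel d) (k : ℤ) : 𝓢(Rd d, ℂ) :=
  𝓕⁻ (K.symbol k)

/-- The Schwartz function `y ↦ g (x - y)`. -/
noncomputable def reflectTranslate {d : ℕ} (g : 𝓢(Rd d, ℂ)) (x : Rd d) : 𝓢(Rd d, ℂ) :=
  compSubConstCLM ℂ x
    (compCLMOfContinuousLinearEquiv ℂ (ContinuousLinearEquiv.neg ℝ (M := Rd d)) g)

theorem reflectTranslate_apply {d : ℕ} (g : 𝓢(Rd d, ℂ)) (x y : Rd d) :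
    reflectTranslate g x y = g (x - y) := by
  simp [reflectTranslate]

/-- The convolution `g ∗ f` of a Schwartz function `g` and a tempered distribution `f`,
`(g ∗ f)(x) = ⟨f, g (x - ·)⟩`. -/
noncomputable def schwartzConv {d : ℕ} (g : 𝓢(Rd d, ℂ)) (f : 𝓢'(Rd d, ℂ)) (x : Rd d) : ℂ :=
  f (reflectTranslate g x)

/-- Polynomials have temperate growth. -/
theorem polynomial_hasTemperateGrowth {d : ℕ} (P : MvPolynomial (Fin d) ℂ) :
    Function.HasTemperateGrowth
      (fun x : Rd d ↦ MvPolynomial.eval (fun i ↦ ((x i : ℝ) : ℂ)) P) := by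
  induction P using MvPolynomial.induction_on with
  | C a => simp
  | add P Q hP hQ =>
    simp only [map_add]
    exact hP.add hQ
  | mul_X P i hP =>
    have h : Function.HasTemperateGrowth (fun x : Rd d ↦ ((x i : ℝ) : ℂ)) :=
      (Complex.ofRealCLM ∘L (EuclideanSpace.proj i : Rd d →L[ℝ] ℝ)).hasTemperateGrowth
    simp only [map_mul, MvPolynomial.eval_X]
    exact hP.mul h

/-- The tempered distribution `g ↦ ∫ g(x) P(x) dx` given by a polynomial `P`. -/
noncomputable def polynomialDistribution {d : ℕ} (P : MvPolynomial (Fin d) ℂ) : 𝓢'(Rd d, ℂ) :=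
  (polynomial_hasTemperateGrowth P).toTemperedDistribution volume

theorem polynomialDistribution_apply {d : ℕ} (P : MvPolynomial (Fin d) ℂ) (g : 𝓢(Rd d, ℂ)) :
    polynomialDistribution P g =
      ∫ x : Rd d, g x * MvPolynomial.eval (fun i ↦ ((x i : ℝ) : ℂ)) P := rfl

theorem integrable_mul_polynomial {d : ℕ} (P : MvPolynomial (Fin d) ℂ) (g : 𝓢(Rd d, ℂ)) :
    Integrable fun x : Rd d ↦ g x * MvPolynomial.eval (fun i ↦ ((x i : ℝ) : ℂ)) P := by
  have h := (bilinLeftCLM (ContinuousLinearMap.lsmul ℂ ℂ)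
    (polynomial_hasTemperateGrowth P) g).integrable (μ := volume)
  exact h

/-- The space `𝓟` of polynomials, as a subspace of the tempered distributions. -/
noncomputable def polynomials (d : ℕ) : Submodule ℂ 𝓢'(Rd d, ℂ) where
  carrier := Set.range polynomialDistribution
  zero_mem' := ⟨0, by ext g; simp [polynomialDistribution_apply]⟩
  add_mem' := by
    rintro _ _ ⟨P, rfl⟩ ⟨Q, rfl⟩
    refine ⟨P + Q, ?_⟩
    ext g
    change polynomialDistribution (P + Q) g =
      polynomialDistribution P g + polynomialDistribution Q g
    simp only [polynomialDistribution_apply, map_add, mul_add]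
    exact integral_add (integrable_mul_polynomial P g) (integrable_mul_polynomial Q g)
  smul_mem' := by
    rintro c _ ⟨P, rfl⟩
    refine ⟨c • P, ?_⟩
    ext g
    change polynomialDistribution (c • P) g = c • polynomialDistribution P g
    simp only [polynomialDistribution_apply, MvPolynomial.smul_eval, smul_eq_mul]
    rw [← integral_const_mul]
    congr 1
    ext x
    ring

/-- The quotient `𝓢' / 𝓟`. -/
abbrev TemperedModPolynomials (d : ℕ) : Type := 𝓢'(Rd d, ℂ) ⧸ polynomials d

/-- A Schwartz function whose Fourier transform vanishes near the origin is orthogonal to all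
polynomials. -/
theorem polynomialDistribution_eq_zero {d : ℕ} (P : MvPolynomial (Fin d) ℂ) :
    ∀ g : 𝓢(Rd d, ℂ), (∀ᶠ ξ in nhds (0 : Rd d), 𝓕 g ξ = 0) → polynomialDistribution P g = 0 := by
  induction P using MvPolynomial.induction_on with
  | C a =>
    intro g hg
    have h0 : 𝓕 g 0 = 0 := hg.self_of_nhds
    rw [fourier_coe, Real.fourier_eq] at h0
    simp only [inner_zero_right, neg_zero, AddChar.map_zero_eq_one, one_smul] at h0
    simp only [polynomialDistribution_apply, MvPolynomial.eval_C, integral_mul_const, h0, zero_mul]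
  | add P Q hP hQ =>
    intro g hg
    have h1 := hP g hg
    have h2 := hQ g hg
    simp only [polynomialDistribution_apply] at h1 h2 ⊢
    simp only [map_add, mul_add]
    rw [integral_add (integrable_mul_polynomial P g) (integrable_mul_polynomial Q g), h1, h2,
      add_zero]
  | mul_X P i hP =>
    intro g hg
    have hT : (fun x : Rd d ↦ inner ℝ x (EuclideanSpace.single i (1 : ℝ))).HasTemperateGrowth := by
      fun_prop
    have key : 𝓕 (smulLeftCLM ℂ (fun x : Rd d ↦ inner ℝ x (EuclideanSpace.single i (1 : ℝ))) g) =
        (-(2 * Real.pi * Complex.I))⁻¹ •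
          LineDeriv.lineDerivOp (EuclideanSpace.single i (1 : ℝ)) (𝓕 g) := by
      rw [lineDerivOp_fourier_eq, FourierTransform.fourier_smul, smul_smul, inv_mul_cancel₀, one_smul]
      simp [Real.pi_ne_zero]
    have h1 := hP (smulLeftCLM ℂ
      (fun x : Rd d ↦ inner ℝ x (EuclideanSpace.single i (1 : ℝ))) g) (by
        have h2 : (fun ξ : Rd d ↦ 𝓕 g ξ) =ᶠ[nhds 0] fun _ ↦ 0 := hg
        filter_upwards [h2.fderiv (𝕜 := ℝ)] with ξ hξ
        have h3 : fderiv ℝ (fun ξ : Rd d ↦ 𝓕 g ξ) ξ = 0 := by simpa using hξ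
        rw [key]
        simp [SchwartzMap.lineDerivOp_apply_eq_fderiv, h3])
    simp only [polynomialDistribution_apply] at h1 ⊢
    rw [← h1]
    congr 1
    ext x
    rw [smulLeftCLM_apply_apply hT]
    simp [EuclideanSpace.inner_single_right]
    ring

theorem fourier_reflectTranslate {d : ℕ} (g : 𝓢(Rd d, ℂ)) (x ξ : Rd d) :
    𝓕 (reflectTranslate g x) ξ = Real.fourierChar (-inner ℝ x ξ) • 𝓕 g (-ξ) := by
  rw [fourier_coe, fourier_coe, Real.fourier_eq, Real.fourier_eq, Circle.smul_def,
    ← integral_smul, ← integral_sub_left_eq_self _ volume x]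
  congr 1
  ext y
  rw [reflectTranslate_apply, sub_sub_cancel, Circle.smul_def, Circle.smul_def, smul_smul,
    ← Circle.coe_mul, ← AddChar.map_add_eq_mul]
  congr 4
  simp [inner_sub_left]
  ring

theorem AveragingKernel.symbol_eventually_zero {d : ℕ} (K : AveragingKernel d) (k : ℤ) :
    ∀ᶠ ξ in nhds (0 : Rd d), K.symbol k ξ = 0 := by
  have h2 : (0 : ℝ) < 2 ^ (-k) := by positivity
  filter_upwards [Metric.ball_mem_nhds (0 : Rd d) (inv_pos.2 h2)] with ξ hξ
  have h3 : ‖(2 : ℝ) ^ (-k) • ξ‖ ≤ 1 := by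
    rw [norm_smul, Real.norm_of_nonneg h2.le]
    have := mul_lt_mul_of_pos_left (mem_ball_zero_iff.1 hξ) h2
    rw [mul_inv_cancel₀ h2.ne'] at this
    exact this.le
  have h4 : ‖(2 : ℝ) ^ (-1 : ℤ) • (2 : ℝ) ^ (-k) • ξ‖ ≤ 1 := by
    rw [norm_smul, Real.norm_of_nonneg (by positivity), zpow_neg_one]
    linarith [norm_nonneg ((2 : ℝ) ^ (-k) • ξ), h3]
  change dyadicDilation 1 (𝓕 K.φ) ((2 : ℝ) ^ (-k) • ξ) - 𝓕 K.φ ((2 : ℝ) ^ (-k) • ξ) = 0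
  rw [dyadicDilation_apply, K.eq_one _ h3, K.eq_one _ h4, sub_self]

/-- Convolution with a dyadic piece annihilates polynomials. -/
theorem schwartzConv_piece_polynomials {d : ℕ} (K : AveragingKernel d) (k : ℤ) (x : Rd d)
    (f : 𝓢'(Rd d, ℂ)) (hf : f ∈ polynomials d) : schwartzConv (K.piece k) f x = 0 := by
  obtain ⟨P, rfl⟩ := hf
  apply polynomialDistribution_eq_zero
  have h : Filter.Tendsto (fun ξ : Rd d ↦ -ξ) (nhds 0) (nhds 0) := by
    simpa using (continuous_neg (G := Rd d)).tendsto 0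
  filter_upwards [h.eventually (K.symbol_eventually_zero k)] with ξ hξ
  rw [fourier_reflectTranslate, AveragingKernel.piece, fourier_fourierInv_eq, hξ, smul_zero]

/-- The homogeneous Triebel--Lizorkin (semi)norm
`‖ (∑_{k ∈ ℤ} |2^{ks} (φ_k ∗ f)|^q)^{1/q} ‖_{L^p}` of a tempered distribution, with values in
`[0, ∞]`. -/
noncomputable def triebelLizorkinSeminorm {d : ℕ} (K : AveragingKernel d) (p q s : ℝ)
    (f : 𝓢'(Rd d, ℂ)) : ℝ≥0∞ :=
  eLpNorm
    (fun x : Rd d ↦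
      (∑' k : ℤ, (ENNReal.ofReal ((2 : ℝ) ^ (k * s)) * ‖schwartzConv (K.piece k) f x‖ₑ) ^ q)
        ^ (1 / q))
    (ENNReal.ofReal p) volume

/-- The homogeneous Triebel--Lizorkin norm on `𝓢' / 𝓟`: the seminorm of any representative. -/
noncomputable def triebelLizorkinNorm {d : ℕ} (K : AveragingKernel d) (p q s : ℝ)
    (u : TemperedModPolynomials d) : ℝ≥0∞ :=
  Quotient.liftOn' u (triebelLizorkinSeminorm K p q s) (by
    intro f g hfg
    have hfg' : f - g ∈ polynomials d := (Submodule.quotientRel_def _).1 hfg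
    have h : ∀ (k : ℤ) (x : Rd d),
        schwartzConv (K.piece k) f x = schwartzConv (K.piece k) g x := by
      intro k x
      have h1 := schwartzConv_piece_polynomials K k x _ hfg'
      have h2 : schwartzConv (K.piece k) (f - g) x =
        schwartzConv (K.piece k) f x - schwartzConv (K.piece k) g x := rfl
      exact sub_eq_zero.1 (h2 ▸ h1)
    simp only [triebelLizorkinSeminorm, h])

theorem triebelLizorkinNorm_mk {d : ℕ} (K : AveragingKernel d) (p q s : ℝ) (f : 𝓢'(Rd d, ℂ)) :
    triebelLizorkinNorm K p q s ((polynomials d).mkQ f) = triebelLizorkinSeminorm K p q s f := rfl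

/-- The homogeneous Triebel--Lizorkin space `Ḟ^{p,q}_s ⊆ 𝓢' / 𝓟`. -/
def triebelLizorkinSpace {d : ℕ} (K : AveragingKernel d) (p q s : ℝ) :
    Set (TemperedModPolynomials d) :=
  {u | triebelLizorkinNorm K p q s u < ∞}

/-- The homogeneous Sobolev space `Ẇ^p_s = Ḟ^{p,2}_s`. -/
def homogeneousSobolevSpace {d : ℕ} (K : AveragingKernel d) (p s : ℝ) :
    Set (TemperedModPolynomials d) :=
  triebelLizorkinSpace K p 2 s

/-- The class in `𝓢' / 𝓟` of the (distributional) Fourier transform of an `L^p` function. -/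
noncomputable def fourierClass {d : ℕ} {p : ℝ≥0∞} [Fact (1 ≤ p)]
    (f : Lp ℂ p (volume : Measure (Rd d))) : TemperedModPolynomials d :=
  (polynomials d).mkQ (𝓕 (Lp.toTemperedDistribution f))

/-- The Fourier transform maps `L^p` boundedly into `Ḟ^{r,q}_s`. -/
def FourierBoundedIntoTriebelLizorkin {d : ℕ} (K : AveragingKernel d) (p : ℝ≥0∞) [Fact (1 ≤ p)]
    (r q s : ℝ) : Prop :=
  (∀ f : Lp ℂ p (volume : Measure (Rd d)), fourierClass f ∈ triebelLizorkinSpace K r q s) ∧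
    ∃ C : ℝ≥0, ∀ f : Lp ℂ p (volume : Measure (Rd d)),
      triebelLizorkinNorm K r q s (fourierClass f) ≤ C * ‖f‖ₑ

/-- The Fourier transform maps `L^p` boundedly into `Ẇ^r_s`. -/
def FourierBoundedIntoSobolev {d : ℕ} (K : AveragingKernel d) (p : ℝ≥0∞) [Fact (1 ≤ p)]
    (r s : ℝ) : Prop :=
  FourierBoundedIntoTriebelLizorkin K p r 2 s

/-! Necessity of the conditions on `s` and `r` comes from explicit test functions. One dyadic symbol
at scale `k`, normalized in `L^p`, has a Fourier transform whose target norm is a constant times `2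
^ (kσ/r)` with `σ = (s - d/p + d) r - d`. Letting `k → ±∞` forces `σ = 0` (`eq_of_bounded`). For `r
≥ p`, superpose `N` symbols at scales `0, 2, 4, …`. Their supports are disjoint, so the `L^p` norm
is at most of order `N ^ (1/p)`. Suitable modulations move the Fourier transforms into disjoint
balls, so the target norm is at least of order `N ^ (1/r)` (`le_of_bounded`).

With `s` determined, `s - d/r = d(2/p - 1) - d/p`, and for `r > p` the inclusion is Jawerth's
embedding (`triebelLizorkinSeminorm_lt_top_of_lt`). Each weighted piece is bounded pointwise both by
a multiple of the square function `F(x)`, decreasing geometrically in `k`, and, through Bernstein's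
inequality, by a multiple of the norm `A`, increasing geometrically in `k`. Summing the minimum
gives `F(x) ^ (p/r) * A ^ (1 - p/r)`, whose `r`-th power is integrable. Bernstein needs
associativity of convolution with a tempered distribution, which rests on exchanging the
distribution with an integral (`distribution_integral_comm`).

Strictness (`exists_seminorm_lt_top_and_not`): localize the modulated weight `(1 + |x|) ^ (-d/p)` to
a frequency annulus. Only three pieces survive, so finiteness of the norms reduces to integrability
of powers of the weight, which lies in `L^r` and not in `L^p`. -/

/-! ### Dilations and the Fourier transform. -/

theorem lintegral_comp_smul_Rd {d : ℕ} {c : ℝ} (hc : c ≠ 0) (g : Rd d → ℝ≥0∞) :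
    ∫⁻ x, g (c • x) = ENNReal.ofReal |(c ^ d)⁻¹| * ∫⁻ x, g x := by
  have h := lintegral_map_equiv (μ := volume) g
    (Homeomorph.smul (isUnit_iff_ne_zero.2 hc).unit : Rd d ≃ₜ Rd d).toMeasurableEquiv
  have h2 : Measure.map (fun x : Rd d ↦ c • x) volume = ENNReal.ofReal |(c ^ d)⁻¹| • volume := by
    simpa using Measure.map_addHaar_smul (volume : Measure (Rd d)) hc
  change ∫⁻ x, g x ∂(Measure.map (fun x : Rd d ↦ c • x) volume) = ∫⁻ x, g (c • x) at h
  rw [← h, h2, lintegral_smul_measure, smul_eq_mul]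

/-- The Fourier transform of a dyadic dilation. -/
theorem fourier_dyadicDilation {d : ℕ} (k : ℤ) (g : 𝓢(Rd d, ℂ)) (x : Rd d) :
    𝓕 (dyadicDilation k g) x = (((2 : ℝ) ^ k) ^ d) • 𝓕 g ((2 : ℝ) ^ k • x) := by
  have h2 : (0 : ℝ) < 2 ^ (-k) := by positivity
  rw [fourier_coe, fourier_coe, Real.fourier_eq, Real.fourier_eq]
  have h := Measure.integral_comp_smul_of_nonneg (volume : Measure (Rd d))
    (fun v ↦ Real.fourierChar (-inner ℝ v ((2 : ℝ) ^ k • x)) • g v) ((2 : ℝ) ^ (-k)) (hR := h2.le)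
  have h3 : ((((2 : ℝ) ^ (-k)) ^ d)⁻¹) = ((2 : ℝ) ^ k) ^ d := by
    rw [zpow_neg, inv_pow, inv_inv]
  rw [finrank_euclideanSpace_fin, h3] at h
  rw [← h]
  congr 1
  ext v
  rw [dyadicDilation_apply, inner_smul_left, inner_smul_right, ← mul_assoc]
  have h4 : (2 : ℝ) ^ (-k) * 2 ^ k = 1 := by
    rw [← zpow_add₀ two_ne_zero, neg_add_cancel, zpow_zero]
  rw [conj_trivial, h4, one_mul]

theorem fourierInv_apply_eq_fourier_neg {d : ℕ} (g : 𝓢(Rd d, ℂ)) (x : Rd d) :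
    𝓕⁻ g x = 𝓕 g (-x) := by
  rw [fourier_coe, fourierInv_coe, Real.fourierInv_eq_fourier_neg]

theorem fourierInv_dyadicDilation {d : ℕ} (k : ℤ) (g : 𝓢(Rd d, ℂ)) (x : Rd d) :
    𝓕⁻ (dyadicDilation k g) x = (((2 : ℝ) ^ k) ^ d) • 𝓕⁻ g ((2 : ℝ) ^ k • x) := by
  rw [fourierInv_apply_eq_fourier_neg, fourierInv_apply_eq_fourier_neg, fourier_dyadicDilation,
    smul_neg]

/-! ### Supports and reproducing identities of the dyadic symbols. -/

namespace AveragingKernel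

variable {d : ℕ} (K : AveragingKernel d)

theorem symbol_apply (k : ℤ) (ξ : Rd d) :
    K.symbol k ξ = 𝓕 K.φ ((2 : ℝ) ^ (-k - 1) • ξ) - 𝓕 K.φ ((2 : ℝ) ^ (-k) • ξ) := by
  have : (2 : ℝ) ^ (-k - 1) • ξ = (2 : ℝ) ^ (-1 : ℤ) • (2 : ℝ) ^ (-k) • ξ := by
    rw [smul_smul, ← zpow_add₀ two_ne_zero]
    congr 2
    ring
  rw [this]
  rfl

theorem symbol_eq_dyadicDilation (k : ℤ) : K.symbol k = dyadicDilation k (K.symbol 0) := by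
  ext ξ
  rw [dyadicDilation_apply, symbol_apply, symbol_apply, smul_smul, smul_smul,
    ← zpow_add₀ two_ne_zero, ← zpow_add₀ two_ne_zero]
  congr 4 <;> ring_nf

theorem fourier_eq_one {ξ : Rd d} {a : ℤ} (h : ‖ξ‖ ≤ 2 ^ (-a)) :
    𝓕 K.φ ((2 : ℝ) ^ a • ξ) = 1 := by
  apply K.eq_one
  have h2 : (0 : ℝ) < 2 ^ a := by positivity
  rw [norm_smul, Real.norm_of_nonneg h2.le]
  refine (mul_le_mul_of_nonneg_left h h2.le).trans_eq ?_
  rw [← zpow_add₀ two_ne_zero, add_neg_cancel, zpow_zero]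

theorem fourier_eq_zero {ξ : Rd d} {a : ℤ} (h : 2 ^ (1 - a) ≤ ‖ξ‖) :
    𝓕 K.φ ((2 : ℝ) ^ a • ξ) = 0 := by
  apply K.eq_zero
  have h2 : (0 : ℝ) < 2 ^ a := by positivity
  rw [norm_smul, Real.norm_of_nonneg h2.le]
  refine Eq.trans_le ?_ (mul_le_mul_of_nonneg_left h h2.le)
  rw [← zpow_add₀ two_ne_zero, add_sub_cancel, zpow_one]

theorem symbol_eq_zero_of_le {k : ℤ} {ξ : Rd d} (h : ‖ξ‖ ≤ 2 ^ k) : K.symbol k ξ = 0 := by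
  rw [symbol_apply, K.fourier_eq_one, K.fourier_eq_one, sub_self]
  · simpa using h
  · exact h.trans (zpow_le_zpow_right₀ one_le_two (by omega))

theorem symbol_eq_zero_of_ge {k : ℤ} {ξ : Rd d} (h : 2 ^ (k + 2) ≤ ‖ξ‖) : K.symbol k ξ = 0 := by
  rw [symbol_apply, K.fourier_eq_zero, K.fourier_eq_zero, sub_self]
  · exact (zpow_le_zpow_right₀ one_le_two (by omega)).trans h
  · exact (zpow_le_zpow_right₀ one_le_two (by omega)).trans h

/-- The sum telescopes to `𝓕 φ (2^{-k-2} ξ) - 𝓕 φ (2^{-k+1} ξ)`; on this annulus the first term is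
`1` and the second `0`. -/
theorem symbol_sum_eq_one {k : ℤ} {ξ : Rd d} (h1 : 2 ^ k ≤ ‖ξ‖) (h2 : ‖ξ‖ ≤ 2 ^ (k + 2)) :
    K.symbol (k - 1) ξ + K.symbol k ξ + K.symbol (k + 1) ξ = 1 := by
  have e1 : -(k - 1) - 1 = -k := by ring
  have e2 : -(k + 1) = -k - 1 := by ring
  rw [symbol_apply, symbol_apply, symbol_apply, e1, e2, K.fourier_eq_one (a := -k - 1 - 1),
    K.fourier_eq_zero (a := -(k - 1))]
  · ring
  · exact (zpow_le_zpow_right₀ one_le_two (by omega)).trans h1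
  · exact h2.trans (zpow_le_zpow_right₀ one_le_two (by omega))

theorem symbol_sum_mul_symbol (k : ℤ) (ξ : Rd d) :
    (K.symbol (k - 1) ξ + K.symbol k ξ + K.symbol (k + 1) ξ) * K.symbol k ξ = K.symbol k ξ := by
  rcases le_total ‖ξ‖ (2 ^ k) with h | h
  · rw [K.symbol_eq_zero_of_le h, mul_zero]
  rcases le_total ‖ξ‖ (2 ^ (k + 2)) with h' | h'
  · rw [K.symbol_sum_eq_one h h', one_mul]
  · rw [K.symbol_eq_zero_of_ge h', mul_zero]

/-- The symbol at scale `j` vanishes off `2^j < |ξ| < 2^(j+2)`, so a gap of two separates supports.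
This is why the test functions use every second scale. -/
theorem symbol_mul_symbol_eq_zero {j k : ℤ} (h : j + 2 ≤ k) (ξ : Rd d) :
    K.symbol j ξ * K.symbol k ξ = 0 := by
  rcases le_total ‖ξ‖ (2 ^ k) with h1 | h1
  · rw [K.symbol_eq_zero_of_le h1, mul_zero]
  · rw [K.symbol_eq_zero_of_ge ((zpow_le_zpow_right₀ one_le_two h).trans h1), zero_mul]

theorem fourier_neg (ξ : Rd d) : 𝓕 K.φ (-ξ) = 𝓕 K.φ ξ := by
  obtain ⟨h, -, hh⟩ := K.radially_decreasing
  rw [hh, hh, norm_neg]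

theorem symbol_neg (k : ℤ) (ξ : Rd d) : K.symbol k (-ξ) = K.symbol k ξ := by
  simp only [symbol_apply, smul_neg, fourier_neg]

theorem conj_fourier (ξ : Rd d) : (starRingEnd ℂ) (𝓕 K.φ ξ) = 𝓕 K.φ ξ := by
  obtain ⟨h, -, hh⟩ := K.radially_decreasing
  rw [hh, Complex.conj_ofReal]

theorem conj_symbol (k : ℤ) (ξ : Rd d) : (starRingEnd ℂ) (K.symbol k ξ) = K.symbol k ξ := by
  simp only [symbol_apply, map_sub, conj_fourier]

theorem symbol_zero_eq_one {ξ : Rd d} (h : ‖ξ‖ = 2) : K.symbol 0 ξ = 1 := by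
  rw [symbol_apply, K.fourier_eq_one, K.fourier_eq_zero, sub_zero]
  · simp [h]
  · simp [h]

theorem fourier_piece (k : ℤ) : 𝓕 (K.piece k) = K.symbol k := by
  rw [piece, fourier_fourierInv_eq]

theorem piece_apply (k : ℤ) (x : Rd d) :
    K.piece k x = (((2 : ℝ) ^ k) ^ d) • K.piece 0 ((2 : ℝ) ^ k • x) := by
  rw [piece, symbol_eq_dyadicDilation, fourierInv_dyadicDilation, piece]

/-- The sum of three consecutive dyadic pieces. -/
noncomputable def widePiece (k : ℤ) : 𝓢(Rd d, ℂ) :=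
  K.piece (k - 1) + K.piece k + K.piece (k + 1)

theorem widePiece_apply (k : ℤ) (x : Rd d) :
    K.widePiece k x = (((2 : ℝ) ^ k) ^ d) • K.widePiece 0 ((2 : ℝ) ^ k • x) := by
  have e (j : ℤ) : K.piece (k + j) x = (((2 : ℝ) ^ k) ^ d) • K.piece j ((2 : ℝ) ^ k • x) := by
    rw [piece_apply, K.piece_apply j, smul_smul, smul_smul, ← mul_pow, ← zpow_add₀ two_ne_zero,
      ← zpow_add₀ two_ne_zero, add_comm j k]
  have h0 := e 0
  rw [add_zero] at h0
  change K.piece (k - 1) x + K.piece k x + K.piece (k + 1) x = (((2 : ℝ) ^ k) ^ d) •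
    (K.piece (0 - 1) _ + K.piece 0 _ + K.piece (0 + 1) _)
  rw [sub_eq_add_neg, e, h0, e, smul_add, smul_add, zero_sub, zero_add]

/-- Convolution of complex-valued Schwartz functions. -/
noncomputable abbrev _root_.SchwartzMap.mulConv (g h : 𝓢(Rd d, ℂ)) : 𝓢(Rd d, ℂ) :=
  SchwartzMap.convolution (ContinuousLinearMap.mul ℂ ℂ) g h

theorem _root_.SchwartzMap.fourier_mulConv (g h : 𝓢(Rd d, ℂ)) (ξ : Rd d) :
    𝓕 (mulConv g h) ξ = 𝓕 g ξ * 𝓕 h ξ := by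
  rw [mulConv, fourier_convolution, pairing_apply_apply]
  rfl

theorem _root_.SchwartzMap.fourier_injective {g h : 𝓢(Rd d, ℂ)} (H : ∀ ξ, 𝓕 g ξ = 𝓕 h ξ) :
    g = h := by
  have h1 : (𝓕 g : 𝓢(Rd d, ℂ)) = 𝓕 h := SchwartzMap.ext H
  have h2 := congrArg (fun u : 𝓢(Rd d, ℂ) ↦ (𝓕⁻ u : 𝓢(Rd d, ℂ))) h1
  simpa using h2

/-- The reproducing formula behind Bernstein's inequality: on the Fourier side the wide symbol is
`1` wherever the narrow one is nonzero. -/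
theorem mulConv_widePiece (k : ℤ) : mulConv (K.widePiece k) (K.piece k) = K.piece k := by
  apply SchwartzMap.fourier_injective
  intro ξ
  rw [SchwartzMap.fourier_mulConv, widePiece, FourierTransform.fourier_add,
    FourierTransform.fourier_add]
  simp only [fourier_piece]
  exact K.symbol_sum_mul_symbol k ξ

end AveragingKernel

/-! ### Translations of Schwartz functions, and distributions applied to integrals. -/

namespace SchwartzMap

variable {d : ℕ}

theorem iteratedFDeriv_compSubConstCLM (h : 𝓢(Rd d, ℂ)) (y z : Rd d) (n : ℕ) :
    iteratedFDeriv ℝ n (compSubConstCLM ℂ y h) z = iteratedFDeriv ℝ n h (z - y) :=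
  iteratedFDeriv_comp_sub n y z

theorem seminorm_compSubConstCLM_le (h : 𝓢(Rd d, ℂ)) (y : Rd d) (k n : ℕ) :
    SchwartzMap.seminorm ℂ k n (compSubConstCLM ℂ y h) ≤
      (2 ^ k * (SchwartzMap.seminorm ℂ k n h + SchwartzMap.seminorm ℂ 0 n h)) * (1 + ‖y‖) ^ k := by
  refine seminorm_le_bound ℂ k n _ (by positivity) fun z ↦ ?_
  rw [iteratedFDeriv_compSubConstCLM]
  have h1 : ‖z‖ ^ k ≤ 2 ^ k * (‖z - y‖ ^ k + ‖y‖ ^ k) := by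
    have h2 : ‖z‖ ≤ ‖z - y‖ + ‖y‖ := by simpa using norm_add_le (z - y) y
    calc ‖z‖ ^ k ≤ (‖z - y‖ + ‖y‖) ^ k := by gcongr
      _ ≤ 2 ^ (k - 1) * (‖z - y‖ ^ k + ‖y‖ ^ k) := add_pow_le (norm_nonneg _) (norm_nonneg _) k
      _ ≤ _ := by gcongr <;> simp
  have h3 := le_seminorm ℂ k n h (z - y)
  have h4 := le_seminorm ℂ 0 n h (z - y)
  rw [pow_zero, one_mul] at h4
  have h5 : ‖y‖ ^ k ≤ (1 + ‖y‖) ^ k := by gcongr; simp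
  have h6 : 1 ≤ (1 + ‖y‖) ^ k := one_le_pow₀ (by simp)
  calc _ ≤ 2 ^ k * (‖z - y‖ ^ k + ‖y‖ ^ k) * ‖iteratedFDeriv ℝ n h (z - y)‖ := by gcongr
    _ = 2 ^ k * (‖z - y‖ ^ k * ‖iteratedFDeriv ℝ n h (z - y)‖ * 1 +
        ‖iteratedFDeriv ℝ n h (z - y)‖ * ‖y‖ ^ k) := by ring
    _ ≤ 2 ^ k * (SchwartzMap.seminorm ℂ k n h * (1 + ‖y‖) ^ k +
        SchwartzMap.seminorm ℂ 0 n h * (1 + ‖y‖) ^ k) := by gcongr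
    _ = _ := by ring

/-- The mean value inequality for the `n`-th derivative, at the cost of one more derivative. The
restriction `‖y‖ ≤ 1` lets the weight at `z` be compared with the weight at every point of the ball
around `z`. -/
theorem seminorm_compSubConstCLM_sub_le (h : 𝓢(Rd d, ℂ)) {y : Rd d} (hy : ‖y‖ ≤ 1) (k n : ℕ) :
    SchwartzMap.seminorm ℂ k n (compSubConstCLM ℂ y h - h) ≤
      (2 ^ k * (SchwartzMap.seminorm ℂ k (n + 1) h + SchwartzMap.seminorm ℂ 0 (n + 1) h)) *
        ‖y‖ := by
  refine seminorm_le_bound ℂ k n _ (by positivity) fun z ↦ ?_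
  have e1 : iteratedFDeriv ℝ n (compSubConstCLM ℂ y h - h : 𝓢(Rd d, ℂ)) z =
      iteratedFDeriv ℝ n h (z - y) - iteratedFDeriv ℝ n h z := by
    rw [← iteratedFDeriv_compSubConstCLM]
    exact iteratedFDeriv_sub_apply ((compSubConstCLM ℂ y h).contDiffAt n) (h.contDiffAt n)
  have hd (w : Rd d) : DifferentiableAt ℝ (iteratedFDeriv ℝ n h) w :=
    ((h.smooth (n + 1 : ℕ)).differentiable_iteratedFDeriv (by exact_mod_cast n.lt_succ_self)) w
  -- The weight is frozen at `‖z‖ ^ k`, so only the derivative of `h` is differentiated.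
  have h1 := (convex_closedBall z ‖y‖).norm_image_sub_le_of_norm_fderiv_le (𝕜 := ℝ)
    (f := fun w ↦ ‖z‖ ^ k • iteratedFDeriv ℝ n h w) (x := z) (y := z - y)
    (C := 2 ^ k * (SchwartzMap.seminorm ℂ k (n + 1) h + SchwartzMap.seminorm ℂ 0 (n + 1) h))
    (fun w _ ↦ (hd w).fun_const_smul _) ?_ (by simp) (by simp)
  · simp only [← smul_sub, norm_smul, norm_pow, norm_norm] at h1
    rw [e1]
    simpa using h1
  · intro w hw
    have hw' : ‖z‖ ≤ ‖w‖ + 1 := by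
      have h2 : ‖z‖ ≤ ‖w‖ + ‖w - z‖ := by
        rw [norm_sub_rev]
        simpa using norm_add_le w (z - w)
      rw [mem_closedBall_iff_norm] at hw
      linarith
    have h1 : ‖z‖ ^ k ≤ 2 ^ k * (‖w‖ ^ k + 1) := by
      calc ‖z‖ ^ k ≤ (‖w‖ + 1) ^ k := by gcongr
        _ ≤ 2 ^ (k - 1) * (‖w‖ ^ k + 1 ^ k) := add_pow_le (norm_nonneg _) zero_le_one k
        _ ≤ _ := by rw [one_pow]; gcongr <;> simp
    have h3 := le_seminorm ℂ k (n + 1) h w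
    have h4 := le_seminorm ℂ 0 (n + 1) h w
    rw [pow_zero, one_mul] at h4
    rw [fderiv_fun_const_smul (hd w), norm_smul, norm_fderiv_iteratedFDeriv, norm_pow, norm_norm]
    calc _ ≤ 2 ^ k * (‖w‖ ^ k + 1) * ‖iteratedFDeriv ℝ (n + 1) h w‖ := by gcongr
      _ = 2 ^ k * (‖w‖ ^ k * ‖iteratedFDeriv ℝ (n + 1) h w‖ +
        ‖iteratedFDeriv ℝ (n + 1) h w‖) := by ring
      _ ≤ _ := by gcongr

/-- Translation is continuous in the Schwartz topology. -/
theorem continuous_compSubConstCLM_apply (h : 𝓢(Rd d, ℂ)) :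
    Continuous fun y : Rd d ↦ compSubConstCLM ℂ y h := by
  rw [continuous_iff_continuousAt]
  intro y₀
  rw [ContinuousAt, (schwartz_withSeminorms ℂ (Rd d) ℂ).tendsto_nhds]
  rintro ⟨k, n⟩ ε hε
  set H := compSubConstCLM ℂ y₀ h with hH
  set M := 2 ^ k * (SchwartzMap.seminorm ℂ k (n + 1) H + SchwartzMap.seminorm ℂ 0 (n + 1) H)
  have h0 : 0 ≤ M := by positivity
  filter_upwards [Metric.ball_mem_nhds y₀ (show 0 < min 1 (ε / (M + 1)) by positivity)] with y hy
  rw [mem_ball_iff_norm, lt_min_iff] at hy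
  have e1 : compSubConstCLM ℂ y h = compSubConstCLM ℂ (y - y₀) H := by
    ext z
    simp [hH]
  have h1 := seminorm_compSubConstCLM_sub_le H hy.1.le k n
  rw [schwartzSeminormFamily_apply, e1]
  refine h1.trans_lt ?_
  calc M * ‖y - y₀‖ ≤ (M + 1) * ‖y - y₀‖ := by gcongr; simp
    _ < (M + 1) * (ε / (M + 1)) := by gcongr; exact hy.2
    _ = ε := by field_simp

/-- The normed space of `n`-linear forms in which the `n`-th derivatives of Schwartz functions take
their values. -/
def DerivTarget (d n : ℕ) : Type := Rd d [×n]→L[ℝ] ℂ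

noncomputable instance (d n : ℕ) : NormedAddCommGroup (DerivTarget d n) :=
  inferInstanceAs (NormedAddCommGroup (Rd d [×n]→L[ℝ] ℂ))

noncomputable instance (d n : ℕ) : NormedSpace ℂ (DerivTarget d n) :=
  inferInstanceAs (NormedSpace ℂ (Rd d [×n]→L[ℝ] ℂ))

noncomputable instance (d n : ℕ) : CompleteSpace (DerivTarget d n) :=
  inferInstanceAs (CompleteSpace (Rd d [×n]→L[ℝ] ℂ))

/-- The `n`-th derivative of a Schwartz function. -/
noncomputable def nthDeriv (n : ℕ) (g : 𝓢(Rd d, ℂ)) (z : Rd d) : DerivTarget d n :=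
  iteratedFDeriv ℝ n g z

theorem norm_nthDeriv (n : ℕ) (g : 𝓢(Rd d, ℂ)) (z : Rd d) :
    ‖nthDeriv n g z‖ = ‖iteratedFDeriv ℝ n g z‖ := rfl

theorem continuous_nthDeriv (n : ℕ) (g : 𝓢(Rd d, ℂ)) : Continuous (nthDeriv n g) :=
  (g.smooth n).continuous_iteratedFDeriv (le_refl _)

theorem nthDeriv_add (n : ℕ) (f g : 𝓢(Rd d, ℂ)) (z : Rd d) :
    nthDeriv n (f + g) z = nthDeriv n f z + nthDeriv n g z :=
  iteratedFDeriv_add_apply (f.contDiffAt n) (g.contDiffAt n)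

theorem nthDeriv_smul (n : ℕ) (c : ℂ) (f : 𝓢(Rd d, ℂ)) (z : Rd d) :
    nthDeriv n (c • f) z = c • nthDeriv n f z :=
  iteratedFDeriv_const_smul_apply (f.contDiffAt n)

/-- The weighted derivative `z ↦ ‖z‖ ^ k D^n g z` of a Schwartz function, as a bounded continuous
function. -/
noncomputable def weightedDeriv (k n : ℕ) (g : 𝓢(Rd d, ℂ)) :
    BoundedContinuousFunction (Rd d) (DerivTarget d n) :=
  BoundedContinuousFunction.ofNormedAddCommGroup
    (fun z ↦ ((‖z‖ ^ k : ℝ) : ℂ) • nthDeriv n g z)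
    (by
      have := continuous_nthDeriv n g
      fun_prop)
    (SchwartzMap.seminorm ℂ k n g)
    (fun z ↦ by
      rw [norm_smul, norm_nthDeriv, Complex.norm_real, norm_pow, norm_norm]
      exact le_seminorm ℂ k n g z)

theorem weightedDeriv_apply (k n : ℕ) (g : 𝓢(Rd d, ℂ)) (z : Rd d) :
    weightedDeriv k n g z = ((‖z‖ ^ k : ℝ) : ℂ) • nthDeriv n g z := rfl

theorem norm_weightedDeriv (k n : ℕ) (g : 𝓢(Rd d, ℂ)) :
    ‖weightedDeriv k n g‖ = SchwartzMap.seminorm ℂ k n g := by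
  apply le_antisymm
  · exact BoundedContinuousFunction.norm_ofNormedAddCommGroup_le _ (apply_nonneg _ _) _
  · refine seminorm_le_bound ℂ k n g (norm_nonneg _) fun z ↦ ?_
    have := (weightedDeriv k n g).norm_coe_le_norm z
    rwa [weightedDeriv_apply, norm_smul, norm_nthDeriv, Complex.norm_real, norm_pow, norm_norm] at this

/-- `weightedDeriv` as a continuous linear map. -/
noncomputable def weightedDerivCLM (d k n : ℕ) :
    𝓢(Rd d, ℂ) →L[ℂ] BoundedContinuousFunction (Rd d) (DerivTarget d n) :=
  mkCLMtoNormedSpace (weightedDeriv k n)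
    (fun f g ↦ by
      ext1 z
      rw [BoundedContinuousFunction.add_apply, weightedDeriv_apply, weightedDeriv_apply,
        weightedDeriv_apply, nthDeriv_add, smul_add])
    (fun c f ↦ by
      ext1 z
      rw [RingHom.id_apply, BoundedContinuousFunction.smul_apply, weightedDeriv_apply,
        weightedDeriv_apply, nthDeriv_smul, smul_comm])
    ⟨{(k, n)}, 1, zero_le_one, fun f ↦ by
      rw [norm_weightedDeriv, Finset.sup_singleton, one_mul]; rfl⟩

/-- A finite family of weighted derivatives. -/
noncomputable def weightedDerivs (d : ℕ) (t : Finset (ℕ × ℕ)) :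
    𝓢(Rd d, ℂ) →L[ℂ]
      ((i : t) → BoundedContinuousFunction (Rd d) (DerivTarget d i.1.2)) :=
  ContinuousLinearMap.pi fun i ↦ weightedDerivCLM d i.1.1 i.1.2

theorem weightedDerivs_apply (t : Finset (ℕ × ℕ)) (g : 𝓢(Rd d, ℂ)) (i : t) :
    weightedDerivs d t g i = weightedDeriv i.1.1 i.1.2 g := rfl

theorem sup_seminorm_le_norm_weightedDerivs (t : Finset (ℕ × ℕ)) (g : 𝓢(Rd d, ℂ)) :
    t.sup (schwartzSeminormFamily ℂ (Rd d) ℂ) g ≤ ‖weightedDerivs d t g‖ := by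
  refine Seminorm.finset_sup_apply_le (norm_nonneg _) fun i hi ↦ ?_
  rw [schwartzSeminormFamily_apply, ← norm_weightedDeriv]
  exact norm_le_pi_norm (weightedDerivs d t g) ⟨i, hi⟩

/-- A tempered distribution extends to a continuous functional on a Banach space of finite
families of bounded continuous functions. -/
theorem exists_dual_comp_weightedDerivs (f : 𝓢'(Rd d, ℂ)) :
    ∃ (t : Finset (ℕ × ℕ))
      (F : StrongDual ℂ
        ((i : t) → BoundedContinuousFunction (Rd d) (DerivTarget d i.1.2))),
      ∀ g, f g = F (weightedDerivs d t g) := by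
  have hf : Continuous fun g : 𝓢(Rd d, ℂ) ↦ f g := f.continuous
  obtain ⟨s, C, -, hC⟩ := Seminorm.bound_of_continuous (schwartz_withSeminorms ℂ (Rd d) ℂ)
    ((normSeminorm ℂ ℂ).comp (f : 𝓢(Rd d, ℂ) →ₗ[ℂ] ℂ)) hf.norm
  -- The index `(0, 0)` adds the sup norm, making `weightedDerivs` injective: `f` then becomes a
  -- bounded functional on its range, ready for Hahn–Banach.
  set t := insert (0, 0) s
  have hb (g : 𝓢(Rd d, ℂ)) : ‖f g‖ ≤ C * ‖weightedDerivs d t g‖ := by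
    refine (hC g).trans ?_
    rw [smul_apply, NNReal.smul_def, smul_eq_mul]
    gcongr
    refine le_trans ?_ (sup_seminorm_le_norm_weightedDerivs t g)
    exact Finset.sup_mono (f := schwartzSeminormFamily ℂ (Rd d) ℂ) (Finset.subset_insert _ _) g
  have hinj : Function.Injective (weightedDerivs d t).toLinearMap := by
    rw [injective_iff_map_eq_zero]
    intro g hg
    have h1 : weightedDeriv 0 0 g = 0 := congrFun hg ⟨(0, 0), Finset.mem_insert_self _ _⟩
    have h2 := norm_weightedDeriv 0 0 g
    rw [h1, norm_zero] at h2
    ext z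
    have h3 := norm_le_seminorm ℂ g z
    rw [← h2] at h3
    simpa using h3
  set e := LinearEquiv.ofInjective (weightedDerivs d t).toLinearMap hinj
  have he (x) : weightedDerivs d t (e.symm x) = x.1 := congrArg Subtype.val (e.apply_symm_apply x)
  obtain ⟨F, hF, -⟩ := exists_extension_norm_eq _
    (LinearMap.mkContinuous ((f : 𝓢(Rd d, ℂ) →ₗ[ℂ] ℂ) ∘ₗ e.symm.toLinearMap) C
      (fun x ↦ (hb (e.symm x)).trans_eq (by rw [he]; rfl)))
  refine ⟨t, F, fun g ↦ ?_⟩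
  have h1 := hF (e g)
  have h2 : e.symm (e g) = g := e.symm_apply_apply g
  change F (weightedDerivs d t g) = f (e.symm (e g)) at h1
  rw [h1, h2]

/-- A tempered distribution commutes with an absolutely convergent integral of Schwartz
functions. -/
theorem distribution_integral_comm (f : 𝓢'(Rd d, ℂ)) {U : Rd d → 𝓢(Rd d, ℂ)} (hU : Continuous U)
    {a : Rd d → ℂ} (ha : Continuous a)
    (hint : ∀ k n, Integrable fun y ↦ ‖a y‖ * SchwartzMap.seminorm ℂ k n (U y))
    {g : 𝓢(Rd d, ℂ)}
    (hg : ∀ n z, nthDeriv n g z = ∫ y, a y • nthDeriv n (U y) z) :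
    f g = ∫ y, a y * f (U y) := by
  obtain ⟨t, F, hF⟩ := exists_dual_comp_weightedDerivs f
  have hcont : Continuous fun y ↦ a y • weightedDerivs d t (U y) :=
    ha.smul ((weightedDerivs d t).continuous.comp hU)
  have hI : Integrable fun y ↦ a y • weightedDerivs d t (U y) := by
    refine Integrable.mono' (g := fun y ↦ ∑ i ∈ t, ‖a y‖ * SchwartzMap.seminorm ℂ i.1 i.2 (U y))
      (integrable_finsetSum _ fun i _ ↦ hint i.1 i.2) hcont.aestronglyMeasurable
      (Filter.Eventually.of_forall fun y ↦ ?_)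
    rw [norm_smul, ← Finset.mul_sum]
    gcongr
    refine (pi_norm_le_iff_of_nonneg (Finset.sum_nonneg fun i _ ↦ apply_nonneg _ _)).2 fun i ↦ ?_
    rw [weightedDerivs_apply, norm_weightedDeriv]
    exact Finset.single_le_sum (f := fun i : ℕ × ℕ ↦ SchwartzMap.seminorm ℂ i.1 i.2 (U y))
      (fun i _ ↦ apply_nonneg _ _) i.2
  -- The right side is a Bochner integral in a Banach space; the identity is checked through the
  -- continuous point evaluations.
  have key : weightedDerivs d t g = ∫ y, a y • weightedDerivs d t (U y) := by
    funext i
    ext1 z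
    have h1 := ((BoundedContinuousFunction.evalCLM ℂ z).comp
      (ContinuousLinearMap.proj (R := ℂ) (φ := fun i : t ↦
        BoundedContinuousFunction (Rd d) (DerivTarget d i.1.2)) i)).integral_comp_comm hI
    change ∫ y, a y • weightedDeriv i.1.1 i.1.2 (U y) z = (∫ y, a y • weightedDerivs d t (U y)) i z
      at h1
    rw [← h1, weightedDerivs_apply, weightedDeriv_apply, hg, ← integral_smul]
    congr 1
    ext1 y
    rw [weightedDeriv_apply, smul_comm]
  rw [hF, key, ← F.integral_comp_comm hI]
  congr 1
  ext1 y
  rw [map_smul, hF, smul_eq_mul]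

end SchwartzMap

/-! ### Associativity of convolution with tempered distributions. -/

namespace SchwartzMap

open LineDeriv

variable {d : ℕ}

theorem mulConv_apply (A h : 𝓢(Rd d, ℂ)) (z : Rd d) : mulConv A h z = ∫ y, A y * h (z - y) := by
  rw [mulConv, convolution_apply, convolution_def]
  rfl

/-- On the Fourier side a derivative is multiplication by `2πi⟨ξ, m⟩`, which may be attached to
either factor. -/
theorem lineDerivOp_mulConv (A h : 𝓢(Rd d, ℂ)) (m : Rd d) :
    ∂_{m} (mulConv A h) = mulConv A (∂_{m} h) := by
  apply SchwartzMap.fourier_injective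
  intro ξ
  have hm : (fun x : Rd d ↦ inner ℝ x m).HasTemperateGrowth := by fun_prop
  rw [fourier_mulConv, fourier_lineDerivOp_eq, fourier_lineDerivOp_eq]
  simp only [smul_apply, smulLeftCLM_apply_apply hm, fourier_mulConv, smul_eq_mul,
    Complex.real_smul]
  ring

theorem iteratedLineDerivOp_mulConv (A h : 𝓢(Rd d, ℂ)) {n : ℕ} (m : Fin n → Rd d) :
    ∂^{m} (mulConv A h) = mulConv A (∂^{m} h) := by
  induction n with
  | zero => rfl
  | succ n ih => rw [iteratedLineDerivOp_succ_left, iteratedLineDerivOp_succ_left, ih,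
      lineDerivOp_mulConv]

/-- Evaluation of `n`-linear forms. -/
noncomputable def derivTargetEval {n : ℕ} (m : Fin n → Rd d) : DerivTarget d n →L[ℂ] ℂ :=
  LinearMap.mkContinuous
    { toFun := fun D : Rd d [×n]→L[ℝ] ℂ ↦ D m
      map_add' := fun _ _ ↦ rfl
      map_smul' := fun _ _ ↦ rfl } (∏ i, ‖m i‖)
    (fun D ↦ (ContinuousMultilinearMap.le_opNorm (show Rd d [×n]→L[ℝ] ℂ from D) m).trans_eq
      (mul_comm _ _))

theorem derivTargetEval_nthDeriv {n : ℕ} (m : Fin n → Rd d) (g : 𝓢(Rd d, ℂ)) (z : Rd d) :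
    derivTargetEval m (nthDeriv n g z) = ∂^{m} g z := by
  rw [iteratedLineDerivOp_eq_iteratedFDeriv]
  rfl

theorem nthDeriv_compSubConstCLM (h : 𝓢(Rd d, ℂ)) (y z : Rd d) (n : ℕ) :
    nthDeriv n (compSubConstCLM ℂ y h) z = nthDeriv n h (z - y) :=
  iteratedFDeriv_compSubConstCLM h y z n

theorem integrable_norm_mul_one_add_pow (A : 𝓢(Rd d, ℂ)) (k : ℕ) :
    Integrable fun y : Rd d ↦ ‖A y‖ * (1 + ‖y‖) ^ k := by
  have h1 : Integrable fun y : Rd d ↦ 2 ^ k * (‖y‖ ^ 0 * ‖A y‖ + ‖y‖ ^ k * ‖A y‖) :=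
    ((A.integrable_pow_mul volume 0).add (A.integrable_pow_mul volume k)).const_mul _
  refine h1.mono' (by have := A.continuous; fun_prop) (Filter.Eventually.of_forall fun y ↦ ?_)
  rw [Real.norm_of_nonneg (by positivity)]
  have h2 : (1 + ‖y‖) ^ k ≤ 2 ^ k * (1 + ‖y‖ ^ k) := by
    calc (1 + ‖y‖) ^ k ≤ 2 ^ (k - 1) * (1 ^ k + ‖y‖ ^ k) := add_pow_le zero_le_one (norm_nonneg _) k
      _ ≤ _ := by rw [one_pow]; gcongr <;> simp
  calc _ ≤ ‖A y‖ * (2 ^ k * (1 + ‖y‖ ^ k)) := by gcongr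
    _ = _ := by ring

theorem integrable_norm_mul_seminorm_compSubConstCLM (A h : 𝓢(Rd d, ℂ)) (k n : ℕ) :
    Integrable fun y : Rd d ↦ ‖A y‖ * SchwartzMap.seminorm ℂ k n (compSubConstCLM ℂ y h) := by
  have hc : Continuous (SchwartzMap.seminorm ℂ k n : 𝓢(Rd d, ℂ) → ℝ) :=
    (schwartz_withSeminorms ℂ (Rd d) ℂ).continuous_seminorm (k, n)
  refine ((integrable_norm_mul_one_add_pow A k).const_mul
    (2 ^ k * (SchwartzMap.seminorm ℂ k n h + SchwartzMap.seminorm ℂ 0 n h))).mono'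
    (A.continuous.norm.mul (hc.comp (continuous_compSubConstCLM_apply h))).aestronglyMeasurable
    (Filter.Eventually.of_forall fun y ↦ ?_)
  rw [Real.norm_of_nonneg (by positivity)]
  exact (mul_le_mul_of_nonneg_left (seminorm_compSubConstCLM_le h y k n)
    (norm_nonneg _)).trans_eq (by ring)

/-- A tempered distribution applied to a convolution. -/
theorem distribution_mulConv (f : 𝓢'(Rd d, ℂ)) (A h : 𝓢(Rd d, ℂ)) :
    f (mulConv A h) = ∫ y, A y * f (compSubConstCLM ℂ y h) := by
  refine distribution_integral_comm f (continuous_compSubConstCLM_apply h) A.continuous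
    (integrable_norm_mul_seminorm_compSubConstCLM A h) fun n z ↦ ?_
  have hI : Integrable fun y ↦ A y • nthDeriv n (compSubConstCLM ℂ y h) z := by
    refine (integrable_norm_mul_seminorm_compSubConstCLM A h 0 n).mono' ?_
      (Filter.Eventually.of_forall fun y ↦ ?_)
    · simp only [nthDeriv_compSubConstCLM]
      have := continuous_nthDeriv n h
      have := A.continuous
      exact Continuous.aestronglyMeasurable (by fun_prop)
    · rw [norm_smul]
      gcongr
      rw [norm_nthDeriv]
      simpa using le_seminorm ℂ 0 n (compSubConstCLM ℂ y h) z
  have key (m : Fin n → Rd d) : derivTargetEval m (nthDeriv n (mulConv A h) z) =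
      derivTargetEval m (∫ y, A y • nthDeriv n (compSubConstCLM ℂ y h) z) := by
    rw [← (derivTargetEval m).integral_comp_comm hI, derivTargetEval_nthDeriv,
      iteratedLineDerivOp_mulConv, mulConv_apply]
    congr 1
    ext1 y
    rw [map_smul, nthDeriv_compSubConstCLM, derivTargetEval_nthDeriv, smul_eq_mul]
  exact ContinuousMultilinearMap.ext key

end SchwartzMap

variable {d : ℕ}

/-- All dependence on `x` is put into the first factor, so that in `distribution_mulConv` only a
fixed reflected `φ` is translated. -/
theorem reflectTranslate_mulConv (ψ φ : 𝓢(Rd d, ℂ)) (x : Rd d) :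
    reflectTranslate (mulConv ψ φ) x = mulConv (reflectTranslate ψ x) (reflectTranslate φ 0) := by
  ext z
  rw [reflectTranslate_apply, mulConv_apply, mulConv_apply,
    ← integral_sub_left_eq_self _ volume x]
  congr 1
  ext1 y
  rw [reflectTranslate_apply, reflectTranslate_apply]
  congr 2
  abel

theorem compSubConstCLM_reflectTranslate_zero (φ : 𝓢(Rd d, ℂ)) (y : Rd d) :
    compSubConstCLM ℂ y (reflectTranslate φ 0) = reflectTranslate φ y := by
  ext z
  rw [reflectTranslate_apply, compSubConstCLM_apply, reflectTranslate_apply]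
  congr 1
  abel

/-- Convolution with a tempered distribution is associative. -/
theorem schwartzConv_mulConv (f : 𝓢'(Rd d, ℂ)) (ψ φ : 𝓢(Rd d, ℂ)) (x : Rd d) :
    schwartzConv (mulConv ψ φ) f x = ∫ y, ψ (x - y) * schwartzConv φ f y := by
  rw [schwartzConv, reflectTranslate_mulConv, distribution_mulConv]
  simp only [reflectTranslate_apply, compSubConstCLM_reflectTranslate_zero, schwartzConv]

theorem continuous_schwartzConv (f : 𝓢'(Rd d, ℂ)) (φ : 𝓢(Rd d, ℂ)) :
    Continuous (schwartzConv φ f) := by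
  have h : Continuous fun y ↦ f (compSubConstCLM ℂ y (reflectTranslate φ 0)) :=
    f.continuous.comp (continuous_compSubConstCLM_apply _)
  simp only [compSubConstCLM_reflectTranslate_zero] at h
  exact h

/-! ### Powers of two and dyadic summation. -/

theorem ofReal_two_rpow (t : ℝ) : ENNReal.ofReal ((2 : ℝ) ^ t) = (2 : ℝ≥0∞) ^ t := by
  rw [← ENNReal.ofReal_rpow_of_pos two_pos, ENNReal.ofReal_ofNat]

theorem two_rpow_add (a b : ℝ) : (2 : ℝ≥0∞) ^ (a + b) = 2 ^ a * 2 ^ b :=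
  ENNReal.rpow_add _ _ two_ne_zero ENNReal.ofNat_ne_top

theorem two_rpow_ne_top (t : ℝ) : (2 : ℝ≥0∞) ^ t ≠ ∞ :=
  ENNReal.rpow_ne_top_of_ne_zero two_ne_zero ENNReal.ofNat_ne_top

theorem enorm_two_zpow_pow (k : ℤ) (d : ℕ) :
    ‖(((2 : ℝ) ^ k) ^ d)‖ₑ = (2 : ℝ≥0∞) ^ ((k : ℝ) * d) := by
  rw [← ofReal_two_rpow, Real.enorm_of_nonneg (by positivity), Real.rpow_mul two_pos.le,
    Real.rpow_intCast, Real.rpow_natCast]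

theorem lintegral_comp_two_zpow_smul {d : ℕ} (k : ℤ) (g : Rd d → ℝ≥0∞) :
    ∫⁻ x, g ((2 : ℝ) ^ k • x) = (2 : ℝ≥0∞) ^ (-((k : ℝ) * d)) * ∫⁻ x, g x := by
  rw [lintegral_comp_smul_Rd (by positivity), abs_of_pos (by positivity), ← ofReal_two_rpow,
    Real.rpow_neg two_pos.le, Real.rpow_mul two_pos.le, Real.rpow_intCast, Real.rpow_natCast]

theorem tsum_two_rpow_neg_abs_ne_top {δ : ℝ} (hδ : 0 < δ) :
    ∑' j : ℤ, (2 : ℝ≥0∞) ^ (-(|(j : ℝ)| * δ)) ≠ ∞ := by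
  have h1 : Summable fun n : ℕ ↦ ((2 : ℝ) ^ (-δ)) ^ n :=
    summable_geometric_of_lt_one (by positivity)
      (Real.rpow_lt_one_of_one_lt_of_neg one_lt_two (by linarith))
  have h2 (n : ℕ) : (2 : ℝ) ^ (-((n : ℝ) * δ)) = ((2 : ℝ) ^ (-δ)) ^ n := by
    rw [← Real.rpow_natCast, ← Real.rpow_mul two_pos.le]
    ring_nf
  have h3 : Summable fun j : ℤ ↦ (2 : ℝ) ^ (-(|(j : ℝ)| * δ)) := by
    refine Summable.of_nat_of_neg ?_ ?_
    · simpa [h2] using h1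
    · simpa [h2] using h1
  simp only [← ofReal_two_rpow]
  exact h3.tsum_ofReal_ne_top

/-- Summation over dyadic scales of the minimum of an increasing and a decreasing geometric
sequence. -/
theorem exists_tsum_le_of_le_two_rpow {α β q : ℝ} (hα : 0 < α) (hβ : 0 < β) (hq : 0 < q) :
    ∃ C : ℝ≥0∞, C ≠ ∞ ∧ ∀ (F B : ℝ≥0∞) (b : ℤ → ℝ≥0∞), B ≠ ∞ →
      (∀ k : ℤ, b k ≤ 2 ^ (-((k : ℝ) * α)) * F) → (∀ k : ℤ, b k ≤ 2 ^ ((k : ℝ) * β) * B) →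
      ∑' k, b k ^ q ≤ C * (F ^ (β / (α + β)) * B ^ (1 - β / (α + β))) ^ q := by
  set γ := min α β
  have hγ : 0 < γ := lt_min hα hβ
  have hαβ : 0 < α + β := by positivity
  set θ := β / (α + β) with hθ
  have hθ0 : 0 < θ := by positivity
  -- The summand `1` makes it immediate that the constant is nonzero, so the right side is infinite
  -- when `F = ∞` and `B ≠ 0`.
  refine ⟨2 ^ (γ * q) * ∑' j : ℤ, (2 : ℝ≥0∞) ^ (-(|(j : ℝ)| * (γ * q))) + 1,
    ENNReal.add_ne_top.2 ⟨ENNReal.mul_ne_top (two_rpow_ne_top _)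
      (tsum_two_rpow_neg_abs_ne_top (by positivity)), ENNReal.one_ne_top⟩, ?_⟩
  intro F B b hB h1 h2
  have hzero (h : ∀ k, b k = 0) : ∑' k, b k ^ q = 0 := by simp [h, hq]
  rcases eq_or_ne F 0 with hF0 | hF0
  · rw [hzero fun k ↦ by simpa [hF0] using h1 k]
    exact zero_le
  rcases eq_or_ne B 0 with hB0 | hB0
  · rw [hzero fun k ↦ by simpa [hB0] using h2 k]
    exact zero_le
  rcases eq_or_ne F ∞ with hFt | hFt
  · have : B ^ (1 - θ) ≠ 0 := by simp [hB0, hB]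
    rw [hFt, ENNReal.top_rpow_of_pos hθ0, ENNReal.top_mul this, ENNReal.top_rpow_of_pos hq,
      ENNReal.mul_top (by simp)]
    exact le_top
  -- `t` is the real scale at which the two bounds coincide; their common value is `F ^ θ * B ^ (1 -
  -- θ)`.
  obtain ⟨t, ht⟩ : ∃ t : ℝ, F = B * 2 ^ (t * (α + β)) := by
    have hx : 0 < F.toReal / B.toReal :=
      div_pos (ENNReal.toReal_pos hF0 hFt) (ENNReal.toReal_pos hB0 hB)
    refine ⟨Real.logb 2 (F.toReal / B.toReal) / (α + β), ?_⟩
    rw [div_mul_cancel₀ _ hαβ.ne', ← ofReal_two_rpow, Real.rpow_logb two_pos (by norm_num) hx,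
      ENNReal.ofReal_div_of_pos (ENNReal.toReal_pos hB0 hB), ENNReal.ofReal_toReal hFt,
      ENNReal.ofReal_toReal hB, ENNReal.mul_div_cancel hB0 hB]
  have hH : F ^ θ * B ^ (1 - θ) = B * 2 ^ (t * β) := by
    rw [ht, ENNReal.mul_rpow_of_nonneg _ _ hθ0.le, ← ENNReal.rpow_mul, mul_right_comm,
      ← ENNReal.rpow_add _ _ hB0 hB, add_sub_cancel, ENNReal.rpow_one, hθ]
    congr 2
    field_simp
  rw [hH]
  set H := B * 2 ^ (t * β) with hHdef
  set m := ⌊t⌋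
  have hm1 : (m : ℝ) ≤ t := Int.floor_le t
  have hm2 : t < m + 1 := Int.lt_floor_add_one t
  -- Away from the crossover the better bound decays at rate at least `γ`; rounding `t` down to `m`
  -- costs a factor `2 ^ γ`.
  have hb (k : ℤ) : b k ≤ H * 2 ^ (γ + -(|((k - m : ℤ) : ℝ)| * γ)) := by
    have key (u : ℝ) (hu : b k ≤ H * 2 ^ u)
        (hu2 : u ≤ γ + -(|((k - m : ℤ) : ℝ)| * γ)) :
        b k ≤ H * 2 ^ (γ + -(|((k - m : ℤ) : ℝ)| * γ)) := by
      refine hu.trans ?_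
      gcongr
      exact one_le_two
    rcases le_or_gt k m with hk | hk
    · refine key ((k - t) * β) ((h2 k).trans_eq ?_) ?_
      · rw [hHdef, mul_assoc, ← two_rpow_add, mul_comm]
        congr 2
        ring
      · have hk' : (k : ℝ) ≤ m := by exact_mod_cast hk
        rw [Int.cast_sub, abs_of_nonpos (by linarith)]
        have : γ ≤ β := min_le_right _ _
        nlinarith
    · refine key ((t - k) * α) ((h1 k).trans_eq ?_) ?_
      · rw [hHdef, ht, mul_left_comm, mul_assoc, ← two_rpow_add, ← two_rpow_add]
        congr 2
        ring
      · have hk' : (m : ℝ) + 1 ≤ k := by exact_mod_cast hk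
        rw [Int.cast_sub, abs_of_nonneg (by linarith)]
        have : γ ≤ α := min_le_left _ _
        nlinarith
  calc ∑' k, b k ^ q
      ≤ ∑' k : ℤ, H ^ q * 2 ^ (γ * q) * 2 ^ (-(|((k - m : ℤ) : ℝ)| * (γ * q))) := by
        gcongr with k
        refine (ENNReal.rpow_le_rpow (hb k) hq.le).trans_eq ?_
        rw [ENNReal.mul_rpow_of_nonneg _ _ hq.le, mul_assoc, ← two_rpow_add, ← ENNReal.rpow_mul]
        congr 2
        ring
    _ = H ^ q * 2 ^ (γ * q) * ∑' j : ℤ, (2 : ℝ≥0∞) ^ (-(|(j : ℝ)| * (γ * q))) := by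
        rw [ENNReal.tsum_mul_left, ← (Equiv.subRight m).tsum_eq
          (fun j : ℤ ↦ (2 : ℝ≥0∞) ^ (-(|(j : ℝ)| * (γ * q))))]
        rfl
    _ ≤ _ := by
        rw [mul_assoc, mul_comm]
        gcongr
        exact le_self_add

/-! ### Bernstein's inequality and the Jawerth embedding. -/

theorem triebelLizorkinSeminorm_eq (K : AveragingKernel d) {p q s : ℝ} (hp : 0 < p)
    (f : 𝓢'(Rd d, ℂ)) :
    triebelLizorkinSeminorm K p q s f = (∫⁻ x : Rd d,
      ((∑' k : ℤ, ((2 : ℝ≥0∞) ^ (k * s) * ‖schwartzConv (K.piece k) f x‖ₑ) ^ q) ^ (1 / q)) ^ p)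
        ^ (1 / p) := by
  rw [triebelLizorkinSeminorm, eLpNorm_eq_lintegral_rpow_enorm_toReal (by simpa)
    ENNReal.ofReal_ne_top, ENNReal.toReal_ofReal hp.le]
  simp only [ofReal_two_rpow, enorm_eq_self]

theorem triebelLizorkinSeminorm_lt_top_iff (K : AveragingKernel d) {p q s : ℝ} (hp : 0 < p)
    (f : 𝓢'(Rd d, ℂ)) :
    triebelLizorkinSeminorm K p q s f < ∞ ↔ ∫⁻ x : Rd d,
      ((∑' k : ℤ, ((2 : ℝ≥0∞) ^ (k * s) * ‖schwartzConv (K.piece k) f x‖ₑ) ^ q) ^ (1 / q)) ^ p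
        < ∞ := by
  rw [triebelLizorkinSeminorm_eq K hp, ENNReal.rpow_lt_top_iff_of_pos (by positivity)]

/-- Only this comparison with the supremum is taken from the source square function, which is why
the embedding leaves `q₀` and `q` unrelated. -/
theorem le_tsum_rpow {q : ℝ} (hq : 0 < q) (b : ℤ → ℝ≥0∞) (k : ℤ) :
    b k ≤ (∑' j, b j ^ q) ^ (1 / q) := by
  rw [one_div, ENNReal.le_rpow_inv_iff hq]
  exact ENNReal.le_tsum (f := fun j ↦ b j ^ q) k

/-- Bernstein's inequality for the dyadic pieces of a tempered distribution. -/
theorem exists_enorm_schwartzConv_piece_le (K : AveragingKernel d) {p : ℝ} (hp : 1 < p) :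
    ∃ C : ℝ≥0∞, C ≠ ∞ ∧ ∀ (f : 𝓢'(Rd d, ℂ)) (k : ℤ) (x : Rd d),
      ‖schwartzConv (K.piece k) f x‖ₑ ≤ C * 2 ^ (k * (d / p)) *
        (∫⁻ y, ‖schwartzConv (K.piece k) f y‖ₑ ^ p) ^ (1 / p) := by
  have hpq := Real.HolderConjugate.conjExponent hp
  set p' := Real.conjExponent p
  have hp0 := hpq.pos
  have hp'0 := hpq.symm.pos
  refine ⟨(∫⁻ y, ‖K.widePiece 0 y‖ₑ ^ p') ^ (1 / p'), ?_, fun f k x ↦ ?_⟩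
  · have h1 := (K.widePiece 0).eLpNorm_lt_top (ENNReal.ofReal p')
    rw [eLpNorm_eq_lintegral_rpow_enorm_toReal (by simpa) ENNReal.ofReal_ne_top,
      ENNReal.toReal_ofReal hp'0.le] at h1
    exact h1.ne
  have h1 : ‖schwartzConv (K.piece k) f x‖ₑ ≤
      ∫⁻ y, ‖K.widePiece k (x - y)‖ₑ * ‖schwartzConv (K.piece k) f y‖ₑ := by
    -- The piece reproduces itself under the wide kernel; Hölder and scaling of that kernel then
    -- give `2 ^ (kd(1 - 1/p')) = 2 ^ (kd/p)`.
    conv_lhs => rw [← K.mulConv_widePiece k, schwartzConv_mulConv]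
    refine (enorm_integral_le_lintegral_enorm _).trans_eq ?_
    simp only [enorm_mul]
  have h2 := ENNReal.lintegral_mul_le_Lp_mul_Lq volume hpq.symm
    (f := fun y ↦ ‖K.widePiece k (x - y)‖ₑ) (g := fun y ↦ ‖schwartzConv (K.piece k) f y‖ₑ)
    (Continuous.aemeasurable (by have := (K.widePiece k).continuous; fun_prop))
    (Continuous.aemeasurable (by have := continuous_schwartzConv f (K.piece k); fun_prop))
  refine h1.trans (h2.trans_eq ?_)
  congr 1
  rw [lintegral_sub_left_eq_self (fun y ↦ ‖K.widePiece k y‖ₑ ^ p') x]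
  simp only [K.widePiece_apply k, enorm_smul, enorm_two_zpow_pow,
    ENNReal.mul_rpow_of_nonneg _ _ hp'0.le]
  rw [lintegral_const_mul' _ _ (ENNReal.rpow_ne_top_of_nonneg hp'0.le (two_rpow_ne_top _)),
    lintegral_comp_two_zpow_smul k (fun y ↦ ‖K.widePiece 0 y‖ₑ ^ p'), ← mul_assoc,
    ← ENNReal.rpow_mul, ← two_rpow_add, ENNReal.mul_rpow_of_nonneg _ _ (by positivity),
    ← ENNReal.rpow_mul, mul_comm]
  congr 2
  have h3 : 1 / p = 1 - 1 / p' := by simpa [eq_sub_iff_add_eq] using hpq.inv_add_inv_eq_one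
  rw [div_eq_mul_one_div (d : ℝ) p, h3]
  field_simp
  ring

/-- The Jawerth embedding between homogeneous Triebel--Lizorkin spaces. -/
theorem triebelLizorkinSeminorm_lt_top_of_lt (hd : 1 ≤ d) (K : AveragingKernel d)
    {p r q₀ q s₀ s : ℝ} (hp : 1 < p) (hpr : p < r) (hq₀ : 0 < q₀) (hq : 0 < q)
    (hs : s₀ - d / p = s - d / r) {f : 𝓢'(Rd d, ℂ)}
    (hf : triebelLizorkinSeminorm K p q₀ s₀ f < ∞) : triebelLizorkinSeminorm K r q s f < ∞ := by
  have hp0 : 0 < p := by linarith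
  have hr0 : 0 < r := by linarith
  have hd0 : (0 : ℝ) < d := by exact_mod_cast hd
  rw [triebelLizorkinSeminorm_lt_top_iff K hr0]
  rw [triebelLizorkinSeminorm_lt_top_iff K hp0] at hf
  set F : Rd d → ℝ≥0∞ := fun x ↦
    (∑' k : ℤ, ((2 : ℝ≥0∞) ^ (k * s₀) * ‖schwartzConv (K.piece k) f x‖ₑ) ^ q₀) ^ (1 / q₀) with hF
  have hkF (k : ℤ) (x : Rd d) : 2 ^ (k * s₀) * ‖schwartzConv (K.piece k) f x‖ₑ ≤ F x :=
    le_tsum_rpow hq₀ (fun k : ℤ ↦ 2 ^ (k * s₀) * ‖schwartzConv (K.piece k) f x‖ₑ) k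
  have hkF' (k : ℤ) (x : Rd d) : ‖schwartzConv (K.piece k) f x‖ₑ ≤ 2 ^ (-(k * s₀)) * F x := by
    calc ‖schwartzConv (K.piece k) f x‖ₑ
        = 2 ^ (-(k * s₀)) * (2 ^ (k * s₀) * ‖schwartzConv (K.piece k) f x‖ₑ) := by
          rw [← mul_assoc, ← two_rpow_add, neg_add_cancel, ENNReal.rpow_zero, one_mul]
      _ ≤ _ := by gcongr; exact hkF k x
  obtain ⟨C, hC, hB⟩ := exists_enorm_schwartzConv_piece_le K hp
  set A := (∫⁻ x, F x ^ p) ^ (1 / p) with hA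
  have hAt : A ≠ ∞ := ENNReal.rpow_ne_top_of_nonneg (by positivity) hf.ne
  have hkA (k : ℤ) : (∫⁻ y, ‖schwartzConv (K.piece k) f y‖ₑ ^ p) ^ (1 / p) ≤
      2 ^ (-(k * s₀)) * A := by
    calc _ ≤ (∫⁻ y, ((2 : ℝ≥0∞) ^ (-(k * s₀))) ^ p * F y ^ p) ^ (1 / p) := by
          gcongr with y
          rw [← ENNReal.mul_rpow_of_nonneg _ _ hp0.le]
          gcongr
          exact hkF' k y
      _ = _ := by
          rw [lintegral_const_mul' _ _ (ENNReal.rpow_ne_top_of_nonneg hp0.le (two_rpow_ne_top _)),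
            ENNReal.mul_rpow_of_nonneg _ _ (by positivity), ← ENNReal.rpow_mul,
            mul_one_div_cancel hp0.ne', ENNReal.rpow_one]
  set α := d / p - d / r with hα
  have hα0 : 0 < α := sub_pos.2 (div_lt_div_of_pos_left hd0 hp0 hpr)
  set β := d / r with hβ
  have hβ0 : 0 < β := by positivity
  -- With this exponent the `r`-th power of `F ^ θ` is exactly `F ^ p`.
  have hθ : β / (α + β) = p / r := by
    rw [hα, hβ]
    field_simp
    simp [hr0.ne']
  obtain ⟨C', hC', hsum⟩ := exists_tsum_le_of_le_two_rpow hα0 hβ0 hq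
  rw [hθ] at hsum
  have hmain (x : Rd d) :
      ((∑' k : ℤ, ((2 : ℝ≥0∞) ^ (k * s) * ‖schwartzConv (K.piece k) f x‖ₑ) ^ q) ^ (1 / q)) ^ r ≤
        (C' ^ (1 / q) * (C * A) ^ (1 - p / r)) ^ r * F x ^ p := by
    have h1 := hsum (F x) (C * A) (fun k ↦ 2 ^ (k * s) * ‖schwartzConv (K.piece k) f x‖ₑ)
      (ENNReal.mul_ne_top hC hAt) (fun k ↦ ?_) (fun k ↦ ?_)
    · calc _ ≤ ((C' * (F x ^ (p / r) * (C * A) ^ (1 - p / r)) ^ q) ^ (1 / q)) ^ r := by gcongr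
        _ = _ := by
          rw [ENNReal.mul_rpow_of_nonneg _ _ (by positivity : 0 ≤ 1 / q), ← ENNReal.rpow_mul _ q,
            mul_one_div_cancel hq.ne', ENNReal.rpow_one, mul_left_comm, mul_comm,
            ENNReal.mul_rpow_of_nonneg _ _ hr0.le, ← ENNReal.rpow_mul _ (p / r),
            div_mul_cancel₀ _ hr0.ne']
    · calc _ ≤ 2 ^ (k * s) * (2 ^ (-(k * s₀)) * F x) := by gcongr; exact hkF' k x
        _ = _ := by
          rw [← mul_assoc, ← two_rpow_add]
          congr 2
          rw [hα]
          linear_combination (-(k : ℝ)) * hs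
    · calc _ ≤ 2 ^ (k * s) * (C * 2 ^ (k * (d / p)) * (2 ^ (-(k * s₀)) * A)) := by
            gcongr
            exact (hB f k x).trans (by gcongr; exact hkA k)
        _ = 2 ^ (k * s) * 2 ^ (k * (d / p)) * 2 ^ (-(k * s₀)) * (C * A) := by ring
        _ = _ := by
          rw [← two_rpow_add, ← two_rpow_add]
          congr 2
          rw [hβ]
          linear_combination (-(k : ℝ)) * hs
  refine (lintegral_mono hmain).trans_lt ?_
  have hne : (C' ^ (1 / q) * (C * A) ^ (1 - p / r)) ^ r ≠ ∞ := by
    refine ENNReal.rpow_ne_top_of_nonneg hr0.le (ENNReal.mul_ne_top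
      (ENNReal.rpow_ne_top_of_nonneg (by positivity) hC')
      (ENNReal.rpow_ne_top_of_nonneg ?_ (ENNReal.mul_ne_top hC hAt)))
    rw [sub_nonneg, div_le_one hr0]
    exact hpr.le
  rw [lintegral_const_mul' _ _ hne]
  exact ENNReal.mul_lt_top hne.lt_top hf

/-! ### Test functions made of modulated dyadic symbols. -/

namespace AveragingKernel

variable (K : AveragingKernel d)

theorem fourier_reflectTranslate_piece (k : ℤ) (x ξ : Rd d) :
    𝓕 (reflectTranslate (K.piece k) x) ξ = Real.fourierChar (-inner ℝ x ξ) • K.symbol k ξ := by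
  rw [fourier_reflectTranslate, fourier_piece, symbol_neg]

/-- The square of the symbol at scale `1`. -/
noncomputable def symbolSq : 𝓢(Rd d, ℂ) :=
  pairing (ContinuousLinearMap.mul ℂ ℂ) (K.symbol 0) (K.symbol 0)

theorem integral_fourierChar_smul_symbol_mul_symbol (k : ℤ) (x : Rd d) :
    ∫ ξ, Real.fourierChar (-inner ℝ x ξ) • (K.symbol k ξ * K.symbol k ξ) =
      (((2 : ℝ) ^ k) ^ d) • 𝓕 K.symbolSq ((2 : ℝ) ^ k • x) := by
  rw [← fourier_dyadicDilation, fourier_coe, Real.fourier_eq]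
  congr 1
  ext1 ξ
  rw [real_inner_comm, dyadicDilation_apply, symbol_eq_dyadicDilation, dyadicDilation_apply]
  rfl

/-- The symbol is real, so this value is its squared `L^2` norm, and the symbol equals `1` on `|ξ| =
2`. -/
theorem fourier_symbolSq_zero_ne_zero (hd : 1 ≤ d) : 𝓕 K.symbolSq 0 ≠ 0 := by
  have h1 : 𝓕 K.symbolSq 0 = ((∫ ξ, ‖K.symbol 0 ξ‖ ^ 2 : ℝ) : ℂ) := by
    rw [fourier_coe, Real.fourier_eq, ← integral_complex_ofReal]
    congr 1
    ext1 ξ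
    rw [inner_zero_right, neg_zero, AddChar.map_zero_eq_one, one_smul]
    change K.symbol 0 ξ * K.symbol 0 ξ = _
    have h2 := Complex.conj_mul' (K.symbol 0 ξ)
    rw [conj_symbol] at h2
    rw [h2, Complex.ofReal_pow]
  rw [h1, Complex.ofReal_ne_zero]
  have hcont : Continuous fun ξ ↦ ‖K.symbol 0 ξ‖ ^ 2 := by
    have := (K.symbol 0).continuous
    fun_prop
  have hint : Integrable fun ξ ↦ ‖K.symbol 0 ξ‖ ^ 2 := by
    have h2 := (memLp_two_iff_integrable_sq_norm
      (K.symbol 0).continuous.aestronglyMeasurable).1 ((K.symbol 0).memLp 2 volume)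
    exact h2
  refine ((integral_pos_iff_support_of_nonneg (fun ξ ↦ by positivity) hint).2 ?_).ne'
  refine hcont.isOpen_support.measure_pos volume
    ⟨EuclideanSpace.single (⟨0, hd⟩ : Fin d) (2 : ℝ), ?_⟩
  rw [Function.mem_support, K.symbol_zero_eq_one (by simp)]
  simp

/-- The `r`-th power integral of `𝓕 (symbolSq)` over an open set containing the origin is
positive. -/
theorem setLIntegral_fourier_symbolSq_pos (hd : 1 ≤ d) {r : ℝ} (hr : 0 < r) {s : Set (Rd d)}
    (hs : IsOpen s) (h0 : 0 ∈ s) : 0 < ∫⁻ x in s, ‖𝓕 K.symbolSq x‖ₑ ^ r := by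
  have hc : Continuous fun x ↦ 𝓕 K.symbolSq x := (𝓕 K.symbolSq).continuous
  rw [setLIntegral_pos_iff (by fun_prop)]
  have h1 : Function.support (fun x ↦ ‖𝓕 K.symbolSq x‖ₑ ^ r) = {x | 𝓕 K.symbolSq x ≠ 0} := by
    ext x
    simp [hr]
  rw [h1]
  exact ((isOpen_ne_fun hc continuous_const).inter hs).measure_pos volume
    ⟨0, K.fourier_symbolSq_zero_ne_zero hd, h0⟩

/-- A superposition of `N` modulated symbols at the scales `k₀ + 2 j`, normalized in `L^p`. -/
noncomputable def testFunction (p : ℝ) (k₀ : ℤ) (a : ℕ → Rd d) (N : ℕ) : 𝓢(Rd d, ℂ) :=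
  ∑ j ∈ Finset.range N, (((2 : ℝ) ^ (-(((k₀ + 2 * j : ℤ) : ℝ) * (d / p))) : ℝ) : ℂ) •
    𝓕 (reflectTranslate (K.piece (k₀ + 2 * j)) (a j))

theorem testFunction_apply (p : ℝ) (k₀ : ℤ) (a : ℕ → Rd d) (N : ℕ) (ξ : Rd d) :
    K.testFunction p k₀ a N ξ = ∑ j ∈ Finset.range N,
      (((2 : ℝ) ^ (-(((k₀ + 2 * j : ℤ) : ℝ) * (d / p))) : ℝ) : ℂ) *
        (Real.fourierChar (-inner ℝ (a j) ξ) • K.symbol (k₀ + 2 * j) ξ) := by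
  rw [testFunction, sum_apply]
  refine Finset.sum_congr rfl fun j _ ↦ ?_
  rw [smul_apply, smul_eq_mul, fourier_reflectTranslate_piece]

theorem symbol_mul_symbol_eq_zero_of_ne (k₀ : ℤ) {i j : ℕ} (h : i ≠ j) (ξ : Rd d) :
    K.symbol (k₀ + 2 * i) ξ * K.symbol (k₀ + 2 * j) ξ = 0 := by
  rcases lt_or_gt_of_ne h with h | h
  · exact K.symbol_mul_symbol_eq_zero (by omega) ξ
  · rw [mul_comm]
    exact K.symbol_mul_symbol_eq_zero (by omega) ξ

/-- At each `ξ` at most one term is nonzero, so `p`-th powers add; the factor `2 ^ (-kd/p)` makes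
every term's `L^p` norm independent of its scale. -/
theorem lintegral_testFunction_le {p : ℝ} (hp : 0 < p) (k₀ : ℤ) (a : ℕ → Rd d) (N : ℕ) :
    ∫⁻ ξ, ‖K.testFunction p k₀ a N ξ‖ₑ ^ p ≤ N * ∫⁻ ξ, ‖K.symbol 0 ξ‖ₑ ^ p := by
  have h1 (ξ : Rd d) : ‖K.testFunction p k₀ a N ξ‖ₑ ^ p ≤ ∑ j ∈ Finset.range N,
      2 ^ (((k₀ + 2 * j : ℤ) : ℝ) * -d) * ‖K.symbol (k₀ + 2 * j) ξ‖ₑ ^ p := by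
    rw [testFunction_apply]
    by_cases h : ∃ i ∈ Finset.range N, K.symbol (k₀ + 2 * i) ξ ≠ 0
    · obtain ⟨i, hi, hne⟩ := h
      rw [Finset.sum_eq_single_of_mem i hi]
      · refine Eq.trans_le ?_ (Finset.single_le_sum (f := fun j : ℕ ↦
          (2 : ℝ≥0∞) ^ (((k₀ + 2 * j : ℤ) : ℝ) * -d) * ‖K.symbol (k₀ + 2 * j) ξ‖ₑ ^ p)
          (fun _ _ ↦ zero_le) hi)
        rw [enorm_mul, ENNReal.mul_rpow_of_nonneg _ _ hp.le, Circle.smul_def, enorm_smul]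
        have e1 : ‖(Real.fourierChar (-inner ℝ (a i) ξ) : ℂ)‖ₑ = 1 := by
          rw [← ofReal_norm, Circle.norm_coe, ENNReal.ofReal_one]
        have e2 (t : ℝ) : ‖(((2 : ℝ) ^ t : ℝ) : ℂ)‖ₑ = 2 ^ t := by
          rw [← ofReal_norm, Complex.norm_real, Real.norm_of_nonneg (by positivity),
            ofReal_two_rpow]
        rw [e1, e2, one_mul, ← ENNReal.rpow_mul]
        congr 2
        field_simp
      · intro j _ hj
        have h2 := K.symbol_mul_symbol_eq_zero_of_ne k₀ hj ξ
        rw [(mul_eq_zero.1 h2).resolve_right hne, smul_zero, mul_zero]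
    · push Not at h
      rw [Finset.sum_eq_zero fun j hj ↦ by rw [h j hj, smul_zero, mul_zero]]
      simp [hp]
  refine (lintegral_mono h1).trans_eq ?_
  have hc (k : ℤ) : Continuous (K.symbol k) := (K.symbol k).continuous
  rw [lintegral_finsetSum _ fun j _ ↦ Measurable.const_mul
    (by have := hc (k₀ + 2 * j); fun_prop) _]
  have h3 (j : ℕ) : ∫⁻ ξ, (2 : ℝ≥0∞) ^ (((k₀ + 2 * j : ℤ) : ℝ) * -d) *
      ‖K.symbol (k₀ + 2 * j) ξ‖ₑ ^ p = ∫⁻ ξ, ‖K.symbol 0 ξ‖ₑ ^ p := by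
    rw [lintegral_const_mul' _ _ (two_rpow_ne_top _)]
    simp only [K.symbol_eq_dyadicDilation (k₀ + 2 * j), dyadicDilation_apply]
    rw [lintegral_comp_two_zpow_smul (-(k₀ + 2 * j)) (fun y ↦ ‖K.symbol 0 y‖ₑ ^ p), ← mul_assoc,
      ← two_rpow_add]
    convert one_mul _
    rw [← ENNReal.rpow_zero (x := 2)]
    congr 1
    push_cast
    ring
  simp only [h3, Finset.sum_const, Finset.card_range, nsmul_eq_mul]

/-- Disjoint supports leave only the `i`-th term, whose symbol is squared by the piece; its
modulation becomes a translation by `a i`. -/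
theorem schwartzConv_piece_fourier_testFunction {p : ℝ} [Fact (1 ≤ ENNReal.ofReal p)] (k₀ : ℤ)
    (a : ℕ → Rd d) {N i : ℕ} (hi : i < N) (x : Rd d) :
    schwartzConv (K.piece (k₀ + 2 * i))
      (𝓕 (Lp.toTemperedDistribution ((K.testFunction p k₀ a N).toLp (ENNReal.ofReal p)))) x =
      (((2 : ℝ) ^ (-(((k₀ + 2 * i : ℤ) : ℝ) * (d / p))) : ℝ) : ℂ) *
        ((((2 : ℝ) ^ (k₀ + 2 * i : ℤ)) ^ d) •
          𝓕 K.symbolSq ((2 : ℝ) ^ (k₀ + 2 * i : ℤ) • (x + a i))) := by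
  rw [← integral_fourierChar_smul_symbol_mul_symbol, ← integral_const_mul, schwartzConv,
    TemperedDistribution.fourier_apply, Lp.toTemperedDistribution_apply]
  apply integral_congr_ae
  filter_upwards [(K.testFunction p k₀ a N).coeFn_toLp (ENNReal.ofReal p) volume] with ξ hξ
  rw [hξ, fourier_reflectTranslate_piece, testFunction_apply, Finset.smul_sum,
    Finset.sum_eq_single_of_mem i (Finset.mem_range.2 hi)]
  · rw [inner_add_left, neg_add, AddChar.map_add_eq_mul]
    simp only [Circle.smul_def, smul_eq_mul, Circle.coe_mul]
    ring
  · intro j _ hj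
    have h2 := K.symbol_mul_symbol_eq_zero_of_ne k₀ hj ξ
    simp only [Circle.smul_def, smul_eq_mul]
    linear_combination (Real.fourierChar (-inner ℝ x ξ) : ℂ) *
      (((2 : ℝ) ^ (-(((k₀ + 2 * j : ℤ) : ℝ) * (d / p))) : ℝ) : ℂ) *
        (Real.fourierChar (-inner ℝ (a j) ξ) : ℂ) * h2

/-- The consequence of the boundedness of the Fourier transform for the test functions. -/
theorem sum_setLIntegral_le_of_bounded {p r q s : ℝ} [Fact (1 ≤ ENNReal.ofReal p)] (hp : 0 < p)
    (hr : 0 < r) (hq : 0 < q) {C : ℝ≥0}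
    (hC : ∀ f : Lp ℂ (ENNReal.ofReal p) (volume : Measure (Rd d)),
      triebelLizorkinNorm K r q s (fourierClass f) ≤ C * ‖f‖ₑ)
    (k₀ : ℤ) (a : ℕ → Rd d) (N : ℕ) {E : ℕ → Set (Rd d)} (hE : ∀ j, MeasurableSet (E j))
    (hdisj : Pairwise (Function.onFun Disjoint E)) :
    ∑ j ∈ Finset.range N, (2 : ℝ≥0∞) ^ (((k₀ + 2 * j : ℤ) : ℝ) * ((s - d / p + d) * r)) *
        ∫⁻ x in E j, ‖𝓕 K.symbolSq ((2 : ℝ) ^ (k₀ + 2 * j : ℤ) • (x + a j))‖ₑ ^ r ≤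
      C ^ r * (∫⁻ ξ, ‖K.symbol 0 ξ‖ₑ ^ p) ^ (r / p) * N ^ (r / p) := by
  set g := K.testFunction p k₀ a N
  set f := g.toLp (ENNReal.ofReal p) volume
  have h1 : ‖f‖ₑ ^ r ≤ (∫⁻ ξ, ‖K.symbol 0 ξ‖ₑ ^ p) ^ (r / p) * N ^ (r / p) := by
    rw [Lp.enorm_def, eLpNorm_congr_ae (g.coeFn_toLp _ _),
      eLpNorm_eq_lintegral_rpow_enorm_toReal (by simpa) ENNReal.ofReal_ne_top,
      ENNReal.toReal_ofReal hp.le, ← ENNReal.rpow_mul, one_div_mul_eq_div,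
      ← ENNReal.mul_rpow_of_nonneg _ _ (by positivity), mul_comm _ (N : ℝ≥0∞)]
    gcongr
    exact K.lintegral_testFunction_le hp k₀ a N
  have h2 : triebelLizorkinSeminorm K r q s (𝓕 (Lp.toTemperedDistribution f)) ≤ C * ‖f‖ₑ := hC f
  rw [triebelLizorkinSeminorm_eq K hr, one_div r, ENNReal.rpow_inv_le_iff hr,
    ENNReal.mul_rpow_of_nonneg _ _ hr.le] at h2
  rw [mul_assoc]
  refine le_trans ?_ (h2.trans (by gcongr))
  -- On `E j` only the entry of the `ℓ^q` sum at scale `k₀ + 2 j` is kept.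
  refine le_trans ?_ (setLIntegral_le_lintegral (⋃ j ∈ Finset.range N, E j) _)
  rw [lintegral_biUnion_finset (fun i _ j _ hij ↦ hdisj hij) (fun j _ ↦ hE j)]
  refine Finset.sum_le_sum fun j hj ↦ ?_
  rw [← lintegral_const_mul' _ _ (two_rpow_ne_top _)]
  refine lintegral_mono fun x ↦ ?_
  refine Eq.trans_le ?_ (ENNReal.rpow_le_rpow (le_tsum_rpow hq _ (k₀ + 2 * j)) hr.le)
  rw [K.schwartzConv_piece_fourier_testFunction k₀ a (Finset.mem_range.1 hj), enorm_mul, enorm_smul,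
    enorm_two_zpow_pow]
  have e2 (t : ℝ) : ‖(((2 : ℝ) ^ t : ℝ) : ℂ)‖ₑ = 2 ^ t := by
    rw [← ofReal_norm, Complex.norm_real, Real.norm_of_nonneg (by positivity), ofReal_two_rpow]
  rw [e2, ← mul_assoc, ← mul_assoc, ← mul_assoc, ← two_rpow_add, ← two_rpow_add,
    ENNReal.mul_rpow_of_nonneg _ _ hr.le, ← ENNReal.rpow_mul]
  congr 2
  ring

end AveragingKernel

/-! ### Necessary conditions on `s` and `r`. -/

namespace AveragingKernel

variable (K : AveragingKernel d)

theorem testConstant_ne_top {p r : ℝ} (hp : 0 < p) (hr : 0 < r) (C : ℝ≥0) :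
    (C : ℝ≥0∞) ^ r * (∫⁻ ξ, ‖K.symbol 0 ξ‖ₑ ^ p) ^ (r / p) ≠ ∞ := by
  have h1 := (K.symbol 0).eLpNorm_lt_top (ENNReal.ofReal p)
  rw [eLpNorm_eq_lintegral_rpow_enorm_toReal (by simpa) ENNReal.ofReal_ne_top,
    ENNReal.toReal_ofReal hp.le, ENNReal.rpow_lt_top_iff_of_pos (by positivity)] at h1
  exact ENNReal.mul_ne_top (ENNReal.rpow_ne_top_of_nonneg hr.le ENNReal.coe_ne_top)
    (ENNReal.rpow_ne_top_of_nonneg (by positivity) h1.ne)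

/-- Boundedness of the Fourier transform forces the smoothness index. -/
theorem eq_of_bounded (hd : 1 ≤ d) {p r q s : ℝ} [Fact (1 ≤ ENNReal.ofReal p)] (hp : 0 < p)
    (hr : 0 < r) (hq : 0 < q) {C : ℝ≥0}
    (hC : ∀ f : Lp ℂ (ENNReal.ofReal p) (volume : Measure (Rd d)),
      triebelLizorkinNorm K r q s (fourierClass f) ≤ C * ‖f‖ₑ) :
    (s - d / p + d) * r = d := by
  set D : ℝ≥0∞ := C ^ r * (∫⁻ ξ, ‖K.symbol 0 ξ‖ₑ ^ p) ^ (r / p) with hD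
  have hDt : D ≠ ∞ := K.testConstant_ne_top hp hr C
  set m : ℝ≥0∞ := ∫⁻ x, ‖𝓕 K.symbolSq x‖ₑ ^ r with hm
  have hm0 : m ≠ 0 := by
    have := K.setLIntegral_fourier_symbolSq_pos hd hr isOpen_univ (Set.mem_univ _)
    rw [setLIntegral_univ] at this
    exact this.ne'
  by_contra hne
  set σ := (s - d / p + d) * r - d with hσ
  have hσ0 : σ ≠ 0 := sub_ne_zero.2 hne
  -- A single unmodulated term integrated over the whole space. The bound is uniform over `k : ℤ`,
  -- hence impossible for either sign of `σ`.
  have key (k : ℤ) : 2 ^ ((k : ℝ) * σ) ≤ D / m := by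
    rw [ENNReal.le_div_iff_mul_le (Or.inl hm0) (Or.inr hDt)]
    have h1 := K.sum_setLIntegral_le_of_bounded hp hr hq hC k (fun _ ↦ 0) 1
      (E := fun j ↦ if j = 0 then Set.univ else ∅) (fun j ↦ by split_ifs <;> simp)
      (fun i j hij ↦ by
        rcases eq_or_ne i 0 with rfl | hi
        · simp [Function.onFun, hij.symm]
        · simp [Function.onFun, hi])
    simp only [Finset.sum_range_one, Nat.cast_zero, mul_zero, add_zero, if_true,
      setLIntegral_univ, Nat.cast_one, ENNReal.one_rpow, mul_one] at h1
    rw [lintegral_comp_two_zpow_smul k (fun y ↦ ‖𝓕 K.symbolSq y‖ₑ ^ r), ← mul_assoc,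
      ← two_rpow_add] at h1
    refine Eq.trans_le ?_ h1
    congr 2
    rw [hσ]
    ring
  have hT : D / m ≠ ∞ := ENNReal.div_ne_top hDt hm0
  obtain ⟨n, hn⟩ := ENNReal.exists_nat_gt hT
  obtain ⟨k, hk⟩ : ∃ k : ℤ, (n : ℝ) ≤ k * σ := by
    rcases lt_or_gt_of_ne hσ0 with h | h
    · refine ⟨⌊n / σ⌋, ?_⟩
      rw [← le_div_iff_of_neg h]
      exact Int.floor_le _
    · refine ⟨⌈n / σ⌉, ?_⟩
      rw [← div_le_iff₀ h]
      exact Int.le_ceil _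
  refine absurd (key k) (not_le.2 (hn.trans_le ?_))
  calc (n : ℝ≥0∞) ≤ 2 ^ n := by exact_mod_cast Nat.lt_two_pow_self.le
    _ = 2 ^ (n : ℝ) := (ENNReal.rpow_natCast _ _).symm
    _ ≤ _ := ENNReal.rpow_le_rpow_of_exponent_le one_le_two hk

/-- The substitution `y = 2^k (x + a)` turns the ball into one of radius `2^k ≥ 1`, which contains
the unit ball. -/
theorem le_setLIntegral_ball {r : ℝ} {k : ℤ} (hk : 0 ≤ k) (a : Rd d) :
    2 ^ ((k : ℝ) * -d) * ∫⁻ x in Metric.ball 0 1, ‖𝓕 K.symbolSq x‖ₑ ^ r ≤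
      ∫⁻ x in Metric.ball (-a) 1, ‖𝓕 K.symbolSq ((2 : ℝ) ^ k • (x + a))‖ₑ ^ r := by
  set G : Rd d → ℝ≥0∞ := (Metric.ball 0 1).indicator fun x ↦ ‖𝓕 K.symbolSq x‖ₑ ^ r with hG
  rw [← lintegral_indicator Metric.isOpen_ball.measurableSet,
    ← lintegral_indicator Metric.isOpen_ball.measurableSet, mul_neg,
    ← lintegral_comp_two_zpow_smul k G, ← lintegral_add_right_eq_self _ a]
  refine lintegral_mono fun x ↦ ?_
  by_cases hx : (2 : ℝ) ^ k • (x + a) ∈ Metric.ball 0 1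
  · have hx' : x ∈ Metric.ball (-a) 1 := by
      rw [mem_ball_zero_iff, norm_smul, Real.norm_of_nonneg (by positivity)] at hx
      rw [mem_ball_iff_norm, sub_neg_eq_add]
      have h1 : (1 : ℝ) ≤ 2 ^ k := one_le_zpow₀ one_le_two hk
      nlinarith [norm_nonneg (x + a)]
    rw [hG, Set.indicator_of_mem hx, Set.indicator_of_mem hx']
  · rw [hG, Set.indicator_of_notMem hx]
    exact zero_le

/-- Boundedness of the Fourier transform forces `p ≤ r`. -/
theorem le_of_bounded (hd : 1 ≤ d) {p r q s : ℝ} [Fact (1 ≤ ENNReal.ofReal p)] (hp : 0 < p)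
    (hr : 0 < r) (hq : 0 < q) {C : ℝ≥0}
    (hC : ∀ f : Lp ℂ (ENNReal.ofReal p) (volume : Measure (Rd d)),
      triebelLizorkinNorm K r q s (fourierClass f) ≤ C * ‖f‖ₑ) : p ≤ r := by
  have hs := K.eq_of_bounded hd hp hr hq hC
  set D : ℝ≥0∞ := C ^ r * (∫⁻ ξ, ‖K.symbol 0 ξ‖ₑ ^ p) ^ (r / p) with hD
  have hDt : D ≠ ∞ := K.testConstant_ne_top hp hr C
  set m : ℝ≥0∞ := ∫⁻ x in Metric.ball 0 1, ‖𝓕 K.symbolSq x‖ₑ ^ r with hm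
  have hm0 : m ≠ 0 := (K.setLIntegral_fourier_symbolSq_pos hd hr Metric.isOpen_ball
    (Metric.mem_ball_self one_pos)).ne'
  have key (N : ℕ) : N * m ≤ D * (N : ℝ≥0∞) ^ (r / p) := by
    -- Centres spaced by `2` along a coordinate axis keep the unit balls disjoint.
    set a : ℕ → Rd d := fun j ↦ EuclideanSpace.single (⟨0, hd⟩ : Fin d) (2 * j : ℝ)
    refine le_trans ?_ (K.sum_setLIntegral_le_of_bounded hp hr hq hC 0 a N
      (E := fun j ↦ Metric.ball (-a j) 1) (fun j ↦ Metric.isOpen_ball.measurableSet) ?_)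
    · rw [← nsmul_eq_mul, ← Finset.card_range N, ← Finset.sum_const, Finset.card_range]
      refine Finset.sum_le_sum fun j _ ↦ ?_
      -- The forced value of `s` makes the factor `2 ^ (kd)` cancel the Jacobian, so each of the `N`
      -- terms contributes at least `m`.
      rw [hs]
      refine le_trans ?_ (mul_le_mul_right (K.le_setLIntegral_ball (by omega) (a j)) _)
      rw [← mul_assoc, ← two_rpow_add, mul_neg, add_neg_cancel, ENNReal.rpow_zero, one_mul]
    · intro i j hij
      refine Metric.ball_disjoint_ball ?_
      rw [dist_neg_neg, PiLp.dist_single_same, Real.dist_eq, ← mul_sub, abs_mul]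
      have h1 : (1 : ℝ) ≤ |(i : ℝ) - j| := by
        have h2 : (1 : ℤ) ≤ |(i : ℤ) - j| :=
          Int.one_le_abs (sub_ne_zero.2 (by exact_mod_cast hij))
        exact_mod_cast h2
      rw [abs_two]
      linarith
  by_contra! hlt
  -- If `r < p`, then `key` would bound `N ^ τ` by `D / m` for all `N`, with `τ > 0`.
  set τ := 1 - r / p with hτ
  have hτ0 : 0 < τ := by
    rw [hτ, sub_pos, div_lt_one hp]
    exact hlt
  have hT : (D / m) ^ τ⁻¹ ≠ ∞ :=
    ENNReal.rpow_ne_top_of_nonneg (by positivity) (ENNReal.div_ne_top hDt hm0)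
  obtain ⟨N, hN⟩ := ENNReal.exists_nat_gt hT
  have hN0 : (N : ℝ≥0∞) ≠ 0 := (bot_le.trans_lt hN).ne'
  have hNt : (N : ℝ≥0∞) ≠ ∞ := ENNReal.natCast_ne_top N
  refine absurd hN (not_lt.2 ?_)
  rw [ENNReal.le_rpow_inv_iff hτ0, ENNReal.le_div_iff_mul_le (Or.inl hm0) (Or.inr hDt)]
  have h0 : (N : ℝ≥0∞) ^ (r / p) ≠ 0 := by simp [hN0, hNt]
  have ht : (N : ℝ≥0∞) ^ (r / p) ≠ ∞ := ENNReal.rpow_ne_top_of_nonneg (by positivity) hNt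
  rw [← ENNReal.mul_le_mul_iff_left h0 ht, mul_right_comm, ← ENNReal.rpow_add _ _ hN0 hNt,
    sub_add_cancel, ENNReal.rpow_one]
  exact key N

end AveragingKernel

/-! ### Polynomial weights and their convolutions. -/

/-- The weight `x ↦ (1 + ‖x‖) ^ (-ρ)`. -/
noncomputable def decayWeight (ρ : ℝ) (x : Rd d) : ℝ := (1 + ‖x‖) ^ (-ρ)

theorem decayWeight_pos (ρ : ℝ) (x : Rd d) : 0 < decayWeight ρ x :=
  Real.rpow_pos_of_pos (by positivity) _

theorem continuous_decayWeight (ρ : ℝ) : Continuous (decayWeight ρ : Rd d → ℝ) := by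
  unfold decayWeight
  exact Continuous.rpow_const (by fun_prop) fun x ↦ Or.inl (by positivity)

theorem decayWeight_le_one {ρ : ℝ} (hρ : 0 ≤ ρ) (x : Rd d) : decayWeight ρ x ≤ 1 :=
  Real.rpow_le_one_of_one_le_of_nonpos (by simp) (by linarith)

theorem decayWeight_rpow (ρ r : ℝ) (x : Rd d) : decayWeight ρ x ^ r = decayWeight (ρ * r) x := by
  rw [decayWeight, decayWeight, ← Real.rpow_mul (by positivity), neg_mul]

/-- From `1 + |x - y| ≤ (1 + |x|)(1 + |y|)` and a nonpositive exponent. It bounds convolutions with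
nonnegative kernels from below. -/
theorem decayWeight_mul_le {ρ : ℝ} (hρ : 0 ≤ ρ) (x y : Rd d) :
    decayWeight ρ x * decayWeight ρ y ≤ decayWeight ρ (x - y) := by
  rw [decayWeight, decayWeight, decayWeight, ← Real.mul_rpow (by positivity) (by positivity)]
  refine Real.rpow_le_rpow_of_nonpos (by positivity) ?_ (by linarith)
  nlinarith [norm_sub_le x y, norm_nonneg x, norm_nonneg y, mul_nonneg (norm_nonneg x)
    (norm_nonneg y)]

/-- The matching upper bound, from `decayWeight_mul_le` at `x - y` and `-y`. A natural exponent `n`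
gives a moment that is integrable against Schwartz functions. -/
theorem decayWeight_sub_le {ρ : ℝ} (hρ : 0 ≤ ρ) {n : ℕ} (hn : ρ ≤ n) (x y : Rd d) :
    decayWeight ρ (x - y) ≤ decayWeight ρ x * (1 + ‖y‖) ^ n := by
  have h1 := decayWeight_mul_le hρ (x - y) (-y)
  rw [sub_neg_eq_add, sub_add_cancel] at h1
  have h2 : (1 : ℝ) ≤ decayWeight ρ (-y) * (1 + ‖y‖) ^ n := by
    rw [decayWeight, norm_neg, ← Real.rpow_natCast, ← Real.rpow_add (by positivity)]
    exact Real.one_le_rpow (by simp) (by linarith)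
  have h3 := (decayWeight_pos ρ (x - y)).le
  calc decayWeight ρ (x - y) ≤ decayWeight ρ (x - y) * (decayWeight ρ (-y) * (1 + ‖y‖) ^ n) :=
        le_mul_of_one_le_right h3 h2
    _ = decayWeight ρ (x - y) * decayWeight ρ (-y) * (1 + ‖y‖) ^ n := by ring
    _ ≤ _ := by gcongr

theorem lintegral_decayWeight_lt_top {ρ : ℝ} (h : d < ρ) :
    ∫⁻ x : Rd d, ENNReal.ofReal (decayWeight ρ x) < ∞ := by
  have h1 : Integrable (fun x : Rd d ↦ (1 + ‖x‖) ^ (-ρ)) :=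
    integrable_one_add_norm (by simpa using h)
  exact (hasFiniteIntegral_iff_ofReal (Filter.Eventually.of_forall fun x ↦
    (decayWeight_pos ρ x).le)).1 h1.2

/-- In polar coordinates the integrand is `y ^ (d-1) (1 + y) ^ (-d)`, which is at least `2 ^ (-d) /
y` for `y > 1`. -/
theorem lintegral_decayWeight_finrank (hd : 1 ≤ d) :
    ∫⁻ x : Rd d, ENNReal.ofReal (decayWeight d x) = ∞ := by
  by_contra hne
  have : Nontrivial (Rd d) := by
    have : Nonempty (Fin d) := ⟨⟨0, hd⟩⟩
    exact (EuclideanSpace.equiv (Fin d) ℝ).symm.injective.nontrivial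
  have h1 : Integrable (fun x : Rd d ↦ (1 + ‖x‖) ^ (-(d : ℝ))) :=
    ⟨(continuous_decayWeight (d : ℝ)).aestronglyMeasurable,
      (hasFiniteIntegral_iff_ofReal (Filter.Eventually.of_forall fun x ↦
        (decayWeight_pos (d : ℝ) x).le)).2 (lt_top_iff_ne_top.2 hne)⟩
  rw [integrable_fun_norm_addHaar volume (f := fun t ↦ (1 + t) ^ (-(d : ℝ)))] at h1
  rw [finrank_euclideanSpace_fin] at h1
  have h2 : IntegrableOn (fun y : ℝ ↦ 2 ^ d * (y ^ (d - 1) • (1 + y) ^ (-(d : ℝ)))) (Set.Ioi 1) :=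
    (h1.mono_set (Set.Ioi_subset_Ioi zero_le_one)).const_mul _
  refine not_integrableOn_Ioi_inv (a := 1) (h2.mono' (by fun_prop) ?_)
  filter_upwards [ae_restrict_mem measurableSet_Ioi] with y hy
  have hy1 : (1 : ℝ) < y := hy
  have hy0 : 0 < y := by linarith
  rw [Real.norm_of_nonneg (by positivity), smul_eq_mul, Real.rpow_neg (by positivity),
    Real.rpow_natCast]
  have h3 : (1 + y) ^ d ≤ 2 ^ d * y ^ d := by
    rw [← mul_pow]
    gcongr
    linarith
  have h4 : y ^ d = y ^ (d - 1) * y := by rw [← pow_succ, Nat.sub_add_cancel hd]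
  rw [← div_eq_mul_inv, ← mul_div_assoc, inv_eq_one_div, div_le_div_iff₀ hy0 (by positivity)]
  rw [one_mul, mul_assoc, ← h4]
  exact h3

/-- The bounded function `x ↦ exp (2πi ⟨v, x⟩) (1 + ‖x‖) ^ (-ρ)`. -/
noncomputable def modulatedWeight (ρ : ℝ) (v x : Rd d) : ℂ :=
  Real.fourierChar (inner ℝ v x) • (decayWeight ρ x : ℂ)

theorem continuous_modulatedWeight (ρ : ℝ) (v : Rd d) : Continuous (modulatedWeight ρ v) := by
  have := continuous_decayWeight (d := d) ρ
  unfold modulatedWeight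
  simp only [Circle.smul_def]
  fun_prop

theorem norm_modulatedWeight (ρ : ℝ) (v x : Rd d) : ‖modulatedWeight ρ v x‖ = decayWeight ρ x := by
  rw [modulatedWeight, Circle.smul_def, norm_smul, Circle.norm_coe, one_mul, Complex.norm_real,
    Real.norm_of_nonneg (decayWeight_pos ρ x).le]

theorem memLp_modulatedWeight {ρ : ℝ} (hρ : 0 ≤ ρ) (v : Rd d) : MemLp (modulatedWeight ρ v) ⊤ :=
  memLp_top_of_bound (continuous_modulatedWeight ρ v).aestronglyMeasurable 1
    (Filter.Eventually.of_forall fun x ↦ by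
      rw [norm_modulatedWeight]
      exact decayWeight_le_one hρ x)

/-- The convolution of a Schwartz function with the modulated weight. -/
noncomputable def weightConv (Q : 𝓢(Rd d, ℂ)) (ρ : ℝ) (v x : Rd d) : ℂ :=
  ∫ z, Q (x - z) * modulatedWeight ρ v z

theorem exists_enorm_weightConv_le (Q : 𝓢(Rd d, ℂ)) {ρ : ℝ} (hρ : 0 ≤ ρ) (v : Rd d) :
    ∃ C : ℝ≥0∞, C ≠ ∞ ∧ ∀ x, ‖weightConv Q ρ v x‖ₑ ≤ C * ENNReal.ofReal (decayWeight ρ x) := by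
  obtain ⟨n, hn⟩ := exists_nat_ge ρ
  have hI := integrable_norm_mul_one_add_pow Q n
  refine ⟨∫⁻ y, ENNReal.ofReal (‖Q y‖ * (1 + ‖y‖) ^ n), ?_, fun x ↦ ?_⟩
  · rw [← ofReal_integral_eq_lintegral_ofReal hI
      (Filter.Eventually.of_forall fun y ↦ by positivity)]
    exact ENNReal.ofReal_ne_top
  · rw [weightConv, ← integral_sub_left_eq_self _ volume x]
    refine (enorm_integral_le_lintegral_enorm _).trans ?_
    rw [← lintegral_mul_const' _ _ ENNReal.ofReal_ne_top]
    refine lintegral_mono fun y ↦ ?_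
    rw [← ofReal_norm, norm_mul, norm_modulatedWeight, sub_sub_cancel,
      ← ENNReal.ofReal_mul (by positivity)]
    refine ENNReal.ofReal_le_ofReal ?_
    calc _ ≤ ‖Q y‖ * (decayWeight ρ x * (1 + ‖y‖) ^ n) := by
          gcongr
          exact decayWeight_sub_le hρ hn x y
      _ = _ := by ring

theorem integrable_weightConv (Q : 𝓢(Rd d, ℂ)) {ρ : ℝ} (hρ : 0 ≤ ρ) (v x : Rd d) :
    Integrable fun z ↦ Q (x - z) * modulatedWeight ρ v z := by
  refine (Q.integrable.comp_sub_left x).mul_bdd (c := 1)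
    (continuous_modulatedWeight ρ v).aestronglyMeasurable
    (Filter.Eventually.of_forall fun z ↦ ?_)
  rw [norm_modulatedWeight]
  exact decayWeight_le_one hρ z

theorem weightConv_add (Q₁ Q₂ : 𝓢(Rd d, ℂ)) {ρ : ℝ} (hρ : 0 ≤ ρ) (v x : Rd d) :
    weightConv (Q₁ + Q₂) ρ v x = weightConv Q₁ ρ v x + weightConv Q₂ ρ v x := by
  rw [weightConv, weightConv, weightConv,
    ← integral_add (integrable_weightConv Q₁ hρ v x) (integrable_weightConv Q₂ hρ v x)]
  simp only [add_apply, add_mul]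

/-- Lower bound for the convolution of the modulated weight with a modulated nonnegative kernel. -/
theorem exists_le_enorm_weightConv {Q A : 𝓢(Rd d, ℂ)} {v : Rd d}
    (hQ : ∀ x, Q x = Real.fourierChar (inner ℝ v x) • ((‖A x‖ ^ 2 : ℝ) : ℂ)) (hA : A ≠ 0)
    {ρ : ℝ} (hρ : 0 ≤ ρ) :
    ∃ c : ℝ≥0∞, c ≠ 0 ∧ ∀ x, c * ENNReal.ofReal (decayWeight ρ x) ≤ ‖weightConv Q ρ v x‖ₑ := by
  have hcont : Continuous fun y ↦ ‖A y‖ ^ 2 * decayWeight ρ y := by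
    have := A.continuous
    have := continuous_decayWeight (d := d) ρ
    fun_prop
  refine ⟨∫⁻ y, ENNReal.ofReal (‖A y‖ ^ 2 * decayWeight ρ y), ?_, fun x ↦ ?_⟩
  · obtain ⟨y, hy⟩ := DFunLike.ne_iff.1 hA
    refine (lintegral_pos_iff_support hcont.measurable.ennreal_ofReal).2 ?_ |>.ne'
    refine (ENNReal.continuous_ofReal.comp hcont).isOpen_support.measure_pos volume ⟨y, ?_⟩
    have h1 : 0 < ‖A y‖ := norm_pos_iff.2 hy
    have h2 := decayWeight_pos ρ y
    rw [Function.mem_support, Function.comp_apply, Ne, ENNReal.ofReal_eq_zero, not_le]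
    positivity
  -- The phases of kernel and weight combine to one independent of `z`, so the integral has no
  -- cancellation.
  · have e1 (z : Rd d) : Q (x - z) * modulatedWeight ρ v z =
        (Real.fourierChar (inner ℝ v x) : ℂ) * ((‖A (x - z)‖ ^ 2 * decayWeight ρ z : ℝ) : ℂ) := by
      rw [hQ, modulatedWeight, Circle.smul_def, Circle.smul_def, smul_eq_mul, smul_eq_mul,
        mul_mul_mul_comm, ← Circle.coe_mul, ← AddChar.map_add_eq_mul, ← inner_add_right,
        sub_add_cancel, ← Complex.ofReal_mul]
    have hI : Integrable fun z ↦ ‖A (x - z)‖ ^ 2 * decayWeight ρ z := by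
      refine (integrable_weightConv Q hρ v x).norm.congr (Filter.Eventually.of_forall fun z ↦ ?_)
      have h2 := (decayWeight_pos ρ z).le
      simp only [e1]
      rw [norm_mul, Circle.norm_coe, one_mul, Complex.norm_real, Real.norm_of_nonneg (by positivity)]
    have hnn (z : Rd d) : 0 ≤ ‖A (x - z)‖ ^ 2 * decayWeight ρ z :=
      mul_nonneg (by positivity) (decayWeight_pos ρ z).le
    simp only [weightConv, e1]
    rw [integral_const_mul, integral_complex_ofReal, ← ofReal_norm, norm_mul, Circle.norm_coe,
      one_mul, Complex.norm_real, Real.norm_of_nonneg (integral_nonneg hnn),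
      ofReal_integral_eq_lintegral_ofReal hI (Filter.Eventually.of_forall hnn),
      ← lintegral_mul_const' _ _ ENNReal.ofReal_ne_top,
      ← lintegral_sub_left_eq_self (fun z ↦ ENNReal.ofReal (‖A (x - z)‖ ^ 2 * decayWeight ρ z)) x]
    refine lintegral_mono fun y ↦ ?_
    rw [← ENNReal.ofReal_mul (mul_nonneg (by positivity) (decayWeight_pos ρ y).le), sub_sub_cancel]
    refine ENNReal.ofReal_le_ofReal ?_
    rw [mul_assoc, mul_comm (decayWeight ρ y)]
    gcongr
    exact decayWeight_mul_le hρ x y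

/-- The image of the modulated weight under a Fourier multiplier. -/
noncomputable def weightMultiplier {ρ : ℝ} (hρ : 0 ≤ ρ) (v : Rd d) (g : 𝓢(Rd d, ℂ)) :
    𝓢'(Rd d, ℂ) :=
  TemperedDistribution.fourierMultiplierCLM ℂ g
    (Lp.toTemperedDistribution (memLp_modulatedWeight hρ v).toLp)

theorem schwartzConv_piece_weightMultiplier (K : AveragingKernel d) {ρ : ℝ} (hρ : 0 ≤ ρ)
    (v : Rd d) (g : 𝓢(Rd d, ℂ)) (k : ℤ) (x : Rd d) :
    schwartzConv (K.piece k) (weightMultiplier hρ v g) x =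
      weightConv (𝓕⁻ (pairing (ContinuousLinearMap.mul ℂ ℂ) g (K.symbol k))) ρ v x := by
  rw [schwartzConv, weightMultiplier, TemperedDistribution.fourierMultiplierCLM_apply_apply,
    Lp.toTemperedDistribution_apply, weightConv]
  apply integral_congr_ae
  filter_upwards [(memLp_modulatedWeight hρ v).coeFn_toLp] with z hz
  rw [hz, smul_eq_mul, fourierInv_apply_eq_fourier_neg, fourier_coe, fourier_coe, Real.fourier_eq,
    Real.fourier_eq]
  congr 2
  ext1 ξ
  rw [smulLeftCLM_apply_apply g.hasTemperateGrowth, fourierInv_apply_eq_fourier_neg,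
    K.fourier_reflectTranslate_piece, K.symbol_neg, pairing_apply_apply,
    ContinuousLinearMap.mul_apply']
  have e : -inner ℝ ξ (-(x - z)) = -inner ℝ ξ z + -inner ℝ x (-ξ) := by
    rw [inner_neg_right, inner_neg_right, inner_sub_right, real_inner_comm x ξ]
    ring
  rw [e, AddChar.map_add_eq_mul]
  simp only [Circle.smul_def, smul_eq_mul, Circle.coe_mul]
  ring

theorem fourierInv_compSubConstCLM (b : 𝓢(Rd d, ℂ)) (v x : Rd d) :
    𝓕⁻ (compSubConstCLM ℂ v b) x = Real.fourierChar (inner ℝ v x) • 𝓕⁻ b x := by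
  rw [fourierInv_coe, fourierInv_coe, Real.fourierInv_eq, Real.fourierInv_eq, Circle.smul_def,
    ← integral_smul, ← integral_add_right_eq_self _ v]
  congr 1
  ext1 ξ
  rw [compSubConstCLM_apply, ← Circle.smul_def, smul_smul, ← AddChar.map_add_eq_mul,
    ← inner_add_left, add_sub_cancel_right,
    add_comm v]

/-- Realness of `𝓕 a` turns `𝓕 (a ∗ a) = (𝓕 a)²` into a nonnegative function. -/
theorem conj_fourier_of_even_real {a : 𝓢(Rd d, ℂ)} (h1 : ∀ ξ, (starRingEnd ℂ) (a ξ) = a ξ)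
    (h2 : ∀ ξ, a (-ξ) = a ξ) (x : Rd d) : (starRingEnd ℂ) (𝓕 a x) = 𝓕 a x := by
  rw [fourier_coe, Real.fourier_eq, ← integral_conj, ← integral_neg_eq_self]
  congr 1
  ext1 ξ
  rw [Circle.smul_def, Circle.smul_def, smul_eq_mul, smul_eq_mul, map_mul, h1, h2,
    inner_neg_left, neg_neg, ← Circle.coe_inv_eq_conj, AddChar.map_neg_eq_inv]

/-! ### A distribution witnessing strictness. -/

namespace AveragingKernel

/-- A multiplier supported in an annulus whose kernel is a modulated nonnegative function. -/
theorem exists_annular_multiplier (K : AveragingKernel d) {v : Rd d} (hv : ‖v‖ = 2) :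
    ∃ g A : 𝓢(Rd d, ℂ), A ≠ 0 ∧ (∀ ξ, g ξ ≠ 0 → 1 < ‖ξ‖ ∧ ‖ξ‖ < 3) ∧
      ∀ x, 𝓕⁻ g x = Real.fourierChar (inner ℝ v x) • ((‖A x‖ ^ 2 : ℝ) : ℂ) := by
  -- Shrinking by four puts the support in `|ξ| ≤ 1/2`, so `a ∗ a` lives in the unit ball, and its
  -- translate by `v`, with `|v| = 2`, in `1 < |ξ| < 3`.
  set a := dyadicDilation (-2) (𝓕 K.φ) with ha
  have ha_apply (ξ : Rd d) : a ξ = 𝓕 K.φ ((2 : ℝ) ^ (2 : ℤ) • ξ) := by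
    rw [ha, dyadicDilation_apply, neg_neg]
  have ha_zero (ξ : Rd d) (h : 1 / 2 ≤ ‖ξ‖) : a ξ = 0 := by
    rw [ha_apply]
    refine K.fourier_eq_zero (le_trans ?_ h)
    norm_num
  set b := mulConv a a with hb
  have hb_zero (ξ : Rd d) (h : 1 ≤ ‖ξ‖) : b ξ = 0 := by
    rw [hb, mulConv_apply]
    refine integral_eq_zero_of_ae (Filter.Eventually.of_forall fun y ↦ ?_)
    rcases le_or_gt (1 / 2) ‖y‖ with hy | hy
    · simp only [ha_zero y hy, zero_mul, Pi.zero_apply]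
    · have h1 : ‖ξ‖ ≤ ‖ξ - y‖ + ‖y‖ := by simpa using norm_add_le (ξ - y) y
      simp only [ha_zero (ξ - y) (by linarith), mul_zero, Pi.zero_apply]
  refine ⟨compSubConstCLM ℂ v b, 𝓕⁻ a, fun h ↦ ?_, fun ξ hξ ↦ ?_, fun x ↦ ?_⟩
  · have h1 : a = 0 := by
      have h2 := congrArg (fun u : 𝓢(Rd d, ℂ) ↦ (𝓕 u : 𝓢(Rd d, ℂ))) h
      simpa using h2
    have h2 : a 0 = 1 := by
      rw [ha_apply]
      exact K.fourier_eq_one (by simp)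
    rw [h1] at h2
    exact zero_ne_one h2
  · rw [compSubConstCLM_apply] at hξ
    have h1 : ‖ξ - v‖ < 1 := not_le.1 fun h ↦ hξ (hb_zero _ h)
    have h2 : ‖v‖ ≤ ‖ξ‖ + ‖ξ - v‖ := by
      rw [norm_sub_rev]
      simpa using norm_add_le ξ (v - ξ)
    have h3 : ‖ξ‖ ≤ ‖ξ - v‖ + ‖v‖ := by simpa using norm_add_le (ξ - v) v
    constructor <;> linarith
  · rw [fourierInv_compSubConstCLM, fourierInv_apply_eq_fourier_neg, hb, fourier_mulConv,
      fourierInv_apply_eq_fourier_neg]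
    congr 1
    have h1 := conj_fourier_of_even_real (a := a) (fun ξ ↦ by rw [ha_apply, K.conj_fourier])
      (fun ξ ↦ by rw [ha_apply, ha_apply, smul_neg, K.fourier_neg]) (-x)
    have h2 := Complex.conj_mul' (𝓕 a (-x))
    rw [h1] at h2
    rw [h2, Complex.ofReal_pow]

/-- A Triebel--Lizorkin space of integrability `r > p` contains a distribution which is in no
Triebel--Lizorkin space of integrability `p`. -/
theorem exists_seminorm_lt_top_and_not (K : AveragingKernel d) (hd : 1 ≤ d) {p r q₀ q : ℝ} (s₀ s : ℝ) (hp : 0 < p)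
    (hpr : p < r) (hq₀ : 0 < q₀) (hq : 0 < q) :
    ∃ f : 𝓢'(Rd d, ℂ), triebelLizorkinSeminorm K r q s f < ∞ ∧
      ¬ triebelLizorkinSeminorm K p q₀ s₀ f < ∞ := by
  have hd0 : (0 : ℝ) < d := by exact_mod_cast hd
  have hr : 0 < r := hp.trans hpr
  set v : Rd d := EuclideanSpace.single (⟨0, hd⟩ : Fin d) (2 : ℝ)
  have hv : ‖v‖ = 2 := by simp [v]
  obtain ⟨g, A, hA, hg, hgA⟩ := K.exists_annular_multiplier hv
  -- The borderline exponent: `ρ p = d` gives a divergent integral, while `ρ r > d` gives a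
  -- convergent one.
  set ρ : ℝ := d / p with hρdef
  have hρ : 0 ≤ ρ := by positivity
  set Q : ℤ → 𝓢(Rd d, ℂ) := fun k ↦
    𝓕⁻ (pairing (ContinuousLinearMap.mul ℂ ℂ) g (K.symbol k)) with hQ
  have hconv (k : ℤ) (x : Rd d) :
      schwartzConv (K.piece k) (weightMultiplier hρ v g) x = weightConv (Q k) ρ v x :=
    schwartzConv_piece_weightMultiplier K hρ v g k x
  -- The annulus `1 < |ξ| < 3` meets only the symbols with `k = -1, 0, 1`.
  have hQ0 (k : ℤ) (hk : k ∉ Finset.Icc (-1 : ℤ) 1) : Q k = 0 := by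
    have h1 : pairing (ContinuousLinearMap.mul ℂ ℂ) g (K.symbol k) = 0 := by
      ext ξ
      rw [pairing_apply_apply, ContinuousLinearMap.mul_apply', zero_apply]
      by_cases h : g ξ = 0
      · rw [h, zero_mul]
      obtain ⟨h1, h2⟩ := hg ξ h
      rw [Finset.mem_Icc, not_and_or, not_le, not_le] at hk
      rcases hk with hk | hk
      · rw [K.symbol_eq_zero_of_ge, mul_zero]
        have h3 : (2 : ℝ) ^ (k + 2) ≤ 2 ^ (0 : ℤ) := zpow_le_zpow_right₀ one_le_two (by omega)
        rw [zpow_zero] at h3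
        linarith
      · rw [K.symbol_eq_zero_of_le, mul_zero]
        have h3 : (2 : ℝ) ^ (2 : ℤ) ≤ 2 ^ k := zpow_le_zpow_right₀ one_le_two (by omega)
        norm_num at h3
        linarith
    rw [hQ]
    simp only [h1]
    exact FourierTransform.fourierInv_zero ..
  have hQsum : 𝓕⁻ g = Q (-1) + Q 0 + Q 1 := by
    rw [hQ]
    simp only [← FourierTransform.fourierInv_add]
    congr 1
    ext ξ
    simp only [add_apply, pairing_apply_apply, ContinuousLinearMap.mul_apply']
    by_cases h : g ξ = 0
    · simp [h]
    obtain ⟨h1, h2⟩ := hg ξ h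
    have h3 := K.symbol_sum_eq_one (k := 0) (ξ := ξ) (by simpa using h1.le)
      (by norm_num; linarith)
    rw [zero_sub, zero_add] at h3
    rw [← mul_add, ← mul_add, h3, mul_one]
  refine ⟨weightMultiplier hρ v g, ?_, fun hfin ↦ ?_⟩
  · rw [triebelLizorkinSeminorm_lt_top_iff K hr]
    choose C hC hCle using fun k ↦ exists_enorm_weightConv_le (Q k) hρ v
    set D : ℝ≥0∞ := (∑ k ∈ Finset.Icc (-1 : ℤ) 1, (2 ^ (k * s) * C k) ^ q) ^ (1 / q)
    have hD : D ≠ ∞ := ENNReal.rpow_ne_top_of_nonneg (by positivity)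
      (ENNReal.sum_ne_top.2 fun k _ ↦ ENNReal.rpow_ne_top_of_nonneg hq.le
        (ENNReal.mul_ne_top (two_rpow_ne_top _) (hC k)))
    have hle (x : Rd d) : ((∑' k : ℤ, ((2 : ℝ≥0∞) ^ (k * s) *
        ‖schwartzConv (K.piece k) (weightMultiplier hρ v g) x‖ₑ) ^ q) ^ (1 / q)) ^ r ≤
        D ^ r * ENNReal.ofReal (decayWeight (ρ * r) x) := by
      rw [← decayWeight_rpow, ← ENNReal.ofReal_rpow_of_pos (decayWeight_pos _ _),
        ← ENNReal.mul_rpow_of_nonneg _ _ hr.le]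
      refine ENNReal.rpow_le_rpow ?_ hr.le
      rw [tsum_eq_sum (s := Finset.Icc (-1 : ℤ) 1)]
      · calc _ ≤ (∑ k ∈ Finset.Icc (-1 : ℤ) 1, (2 ^ (k * s) * C k) ^ q *
              ENNReal.ofReal (decayWeight ρ x) ^ q) ^ (1 / q) := by
              gcongr with k
              rw [← ENNReal.mul_rpow_of_nonneg _ _ hq.le, mul_assoc, hconv]
              gcongr
              exact hCle k x
          _ = _ := by
              rw [← Finset.sum_mul, ENNReal.mul_rpow_of_nonneg _ _ (by positivity),
                ← ENNReal.rpow_mul, mul_one_div_cancel hq.ne', ENNReal.rpow_one]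
      · intro k hk
        rw [hconv, hQ0 k hk]
        simp [weightConv, hq]
    refine (lintegral_mono hle).trans_lt ?_
    have hDr : D ^ r ≠ ∞ := ENNReal.rpow_ne_top_of_nonneg hr.le hD
    rw [lintegral_const_mul' _ _ hDr]
    refine ENNReal.mul_lt_top hDr.lt_top (lintegral_decayWeight_lt_top ?_)
    rw [hρdef, div_mul_eq_mul_div, lt_div_iff₀ hp]
    gcongr
  · rw [triebelLizorkinSeminorm_lt_top_iff K hp] at hfin
    set F : Rd d → ℝ≥0∞ := fun x ↦ (∑' k : ℤ, ((2 : ℝ≥0∞) ^ (k * s₀) *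
      ‖schwartzConv (K.piece k) (weightMultiplier hρ v g) x‖ₑ) ^ q₀) ^ (1 / q₀) with hF
    have hkF (k : ℤ) (x : Rd d) : ‖weightConv (Q k) ρ v x‖ₑ ≤ 2 ^ (-(k * s₀)) * F x := by
      calc ‖weightConv (Q k) ρ v x‖ₑ
          = 2 ^ (-(k * s₀)) * (2 ^ (k * s₀) * ‖weightConv (Q k) ρ v x‖ₑ) := by
            rw [← mul_assoc, ← two_rpow_add, neg_add_cancel, ENNReal.rpow_zero, one_mul]
        _ ≤ _ := by
            rw [← hconv]
            gcongr
            exact le_tsum_rpow hq₀ (fun k : ℤ ↦ 2 ^ (k * s₀) *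
              ‖schwartzConv (K.piece k) (weightMultiplier hρ v g) x‖ₑ) k
    obtain ⟨c, hc, hcle⟩ := exists_le_enorm_weightConv hgA hA hρ
    set D : ℝ≥0∞ := 2 ^ (-(((-1 : ℤ) : ℝ) * s₀)) + 2 ^ (-(((0 : ℤ) : ℝ) * s₀)) +
      2 ^ (-(((1 : ℤ) : ℝ) * s₀))
    have hD : D ≠ ∞ := by simp [D]
    -- The three surviving kernels add up to `𝓕⁻ g`, so its lower bound passes to `F`.
    have hle (x : Rd d) : c * ENNReal.ofReal (decayWeight ρ x) ≤ D * F x := by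
      have h1 : weightConv (𝓕⁻ g) ρ v x =
          weightConv (Q (-1)) ρ v x + weightConv (Q 0) ρ v x + weightConv (Q 1) ρ v x := by
        rw [hQsum, weightConv_add _ _ hρ, weightConv_add _ _ hρ]
      refine (hcle x).trans ?_
      rw [h1, add_mul, add_mul]
      refine (enorm_add_le _ _).trans (add_le_add ((enorm_add_le _ _).trans (add_le_add ?_ ?_)) ?_)
      · exact hkF (-1) x
      · exact hkF 0 x
      · exact hkF 1 x
    have hle' (x : Rd d) :
        c ^ p * ENNReal.ofReal (decayWeight (d : ℝ) x) ≤ D ^ p * F x ^ p := by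
      have e : (d : ℝ) = ρ * p := by
        rw [hρdef]
        field_simp
      rw [e, ← decayWeight_rpow, ← ENNReal.ofReal_rpow_of_pos (decayWeight_pos _ _),
        ← ENNReal.mul_rpow_of_nonneg _ _ hp.le, ← ENNReal.mul_rpow_of_nonneg _ _ hp.le]
      exact ENNReal.rpow_le_rpow (hle x) hp.le
    have hDp : D ^ p ≠ ∞ := ENNReal.rpow_ne_top_of_nonneg hp.le hD
    have h2 := lintegral_mono (μ := volume) hle'
    rw [lintegral_const_mul' _ _ hDp, lintegral_const_mul _
      (continuous_decayWeight (d : ℝ)).measurable.ennreal_ofReal,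
      lintegral_decayWeight_finrank hd, ENNReal.mul_top (by simp [hc, hp.le])] at h2
    exact absurd h2 (not_le.2 (ENNReal.mul_lt_top hDp.lt_top hfin))

end AveragingKernel

/-! ### Assembly of the theorem. -/

theorem homogeneousSobolevSpace_ssubset (hd : 1 ≤ d) (K : AveragingKernel d) {p r q s₀ s : ℝ}
    (hp : 1 < p) (hpr : p < r) (hq : 0 < q) (hs : s₀ - d / p = s - d / r) :
    homogeneousSobolevSpace K p s₀ ⊂ triebelLizorkinSpace K r q s := by
  refine (Set.ssubset_iff_of_subset fun u hu ↦ ?_).2 ?_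
  · obtain ⟨f, rfl⟩ := (polynomials d).mkQ_surjective u
    exact triebelLizorkinSeminorm_lt_top_of_lt hd K hp hpr two_pos hq hs hu
  · obtain ⟨f, hf, hf'⟩ := K.exists_seminorm_lt_top_and_not hd s₀ s (by linarith) hpr two_pos hq
    exact ⟨(polynomials d).mkQ f, hf, hf'⟩

theorem mainTheorem10 (d : ℕ) (hd : 1 ≤ d) (K : AveragingKernel d)
    (p : ℝ) [Fact (1 ≤ ENNReal.ofReal p)] (hp : 2 < p) :
    (∀ r q s : ℝ, 1 < r → 1 < q →
      FourierBoundedIntoTriebelLizorkin K (ENNReal.ofReal p) r q s →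
        s = d * (1 / p - 1 / Real.conjExponent r) ∧
        p ≤ r ∧
        (p < r →
          homogeneousSobolevSpace K p (d * (2 / p - 1)) ⊂ triebelLizorkinSpace K r q s)) ∧
    (∀ r s : ℝ, 1 < r →
      FourierBoundedIntoSobolev K (ENNReal.ofReal p) r s →
        homogeneousSobolevSpace K p (d * (2 / p - 1)) ⊆ homogeneousSobolevSpace K r s ∧
        (homogeneousSobolevSpace K p (d * (2 / p - 1)) = homogeneousSobolevSpace K r s ↔
          r = p ∧ s = d * (2 / p - 1))) := by
  have h1 : ∀ r q s : ℝ, 1 < r → 1 < q →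
      FourierBoundedIntoTriebelLizorkin K (ENNReal.ofReal p) r q s →
        s = d * (1 / p - 1 / Real.conjExponent r) ∧
        p ≤ r ∧
        (p < r →
          homogeneousSobolevSpace K p (d * (2 / p - 1)) ⊂ triebelLizorkinSpace K r q s) := by
    rintro r q s hr hq ⟨-, C, hC⟩
    have hp0 : 0 < p := by linarith
    have hr0 : 0 < r := by linarith
    have hq0 : 0 < q := by linarith
    have hs := K.eq_of_bounded hd hp0 hr0 hq0 hC
    have hs' : s = d / r + d / p - d := by
      rw [← eq_div_iff hr0.ne'] at hs
      linarith
    refine ⟨?_, K.le_of_bounded hd hp0 hr0 hq0 hC, fun hpr ↦ ?_⟩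
    · rw [hs', Real.conjExponent]
      have : r - 1 ≠ 0 := by linarith
      field_simp
      ring
    -- Both sides of the remaining index condition equal `d/p - d`.
    · refine homogeneousSobolevSpace_ssubset hd K (by linarith) hpr hq0 ?_
      rw [hs']
      ring
  refine ⟨h1, fun r s hr hb ↦ ?_⟩
  obtain ⟨hs, hpr, hsub⟩ := h1 r 2 s hr one_lt_two hb
  -- For `r = p` the formula for `s` reduces to `d(2/p - 1)` and the spaces coincide; for `r > p`
  -- the inclusion is proper.
  rcases hpr.eq_or_lt with rfl | hlt
  · have hs' : s = d * (2 / p - 1) := by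
      rw [hs, Real.conjExponent]
      have : p - 1 ≠ 0 := by linarith
      field_simp
      ring
    rw [hs']
    exact ⟨subset_rfl, iff_of_true rfl ⟨rfl, rfl⟩⟩
  · exact ⟨(hsub hlt).subset, iff_of_false (hsub hlt).ne fun h ↦ hlt.ne' h.1⟩
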